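/- Let $G$ be a finite connected graph without loops, with adjacency matrix $A(G)$. An arithmetical structure on $G$ is a pair $(\mathbf d,\mathbf r)$ of integer vectors indexed by $V(G)$ such that $\mathbf d$ has nonnegative entries, $\mathbf r$ has positive entries with no nontrivial common factor, and $(\operatorname{diag}(\mathbf d)-A(G))\mathbf r=\mathbf 0$. Its critical group is the torsion subgroup of the cokernel $\mathbb Z^{V(G)}/\operatorname{im}(\operatorname{diag}(\mathbf d)-A(G))$. The number of invariant factors of a finite abelian group $K$ is the number $s$ in the decomposition $K\cong\bigoplus_{i=1}^s\mathbb Z/\alpha_i\mathbb Z$ with $\alpha_i>1$ and $\alpha_1\mid\alpha_2\mid\cdots\mid\alpha_s$. A starlike tree is a tree with exactly one vertex of degree at least $3$, called its central vertex. If a tree $T$ has more than one vertex of degree at least $3$, a starlike splitting of $T$ is a tuple $(S,T',v_s,v_t)$ where $S$ is a starlike tree, $T'$ is a tree, $v_s$ is a leaf of $S$ adjacent to its central vertex, $v_t$ is a vertex of $T'$, and $T$ is obtained from $S$ and $T'$ by identifying $v_s$ with $v_t$. Starlike decompositions are defined recursively: if $T$ has at most one vertex of degree at least $3$, then its only starlike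 decomposition is $\{T\}$; otherwise, the starlike decompositions of $T$ are the collections $\{S_i\}_{i=1}^k$ where $(S_1,T',v_s,v_t)$ is a starlike splitting of $T$ and $\{S_i\}_{i=2}^k$ is a starlike decomposition of $T'$. Theorem. Let $T$ be a finite tree with at least $2$ vertices, let $\{S_i\}_{i=1}^k$ be a starlike decomposition of $T$, and let $\ell_i$ be the number of leaves (vertices of degree $1$) of $S_i$. (a) The critical group of any arithmetical structure on $T$ is a finite abelian group whose number of invariant factors is at most $\sum_{i=1}^k(\ell_i-2)$. (b) For every integer $t$ with $0\le t\le\sum_{i=1}^k(\ell_i-2)$, there is an arithmetical structure on $T$ whose critical group is isomorphic to $(\mathbb Z/2\mathbb Z)^t$; in particular, it has exactly $t$ invariant factors. -/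

import Mathlib

universe u

section Arithmetical

variable {V : Type u} [Fintype V]

open scoped Classical in
/-- The generalized Laplacian matrix `L(G, d) = diag(d) - A(G)`. -/
noncomputable def generalizedLaplacian (G : SimpleGraph V) (d : V → ℤ) : Matrix V V ℤ :=
  Matrix.diagonal d - G.adjMatrix ℤ

/-- `(d, r)` is an arithmetical structure on `G`: `d` is nonnegative, `r` is positive, the entries
of `r` have no nontrivial common factor, and `(diag(d) - A(G)) r = 0`. -/
structure IsArithmeticalStructure (G : SimpleGraph V) (d r : V → ℤ) : Prop where
  d_nonneg : ∀ v, 0 ≤ d v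
  r_pos : ∀ v, 0 < r v
  r_primitive : ∀ k : ℤ, (∀ v, k ∣ r v) → IsUnit k
  laplacian_mulVec : (generalizedLaplacian G d).mulVec r = 0

/-- The cokernel `ℤ^V / im L(G, d)`. -/
abbrev LaplacianCokernel (G : SimpleGraph V) (d : V → ℤ) : Type u :=
  (V → ℤ) ⧸ LinearMap.range (generalizedLaplacian G d).mulVecLin

/-- The critical group: the torsion part of the cokernel of `L(G, d)`.
(Since `r` is determined by `d`, it does not enter the definition.) -/
abbrev CriticalGroup (G : SimpleGraph V) (d : V → ℤ) : Type u :=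
  Submodule.torsion ℤ (LaplacianCokernel G d)

end Arithmetical

/-- `α 0 ∣ α 1 ∣ ⋯ ∣ α (s - 1)`, all greater than `1`, are the invariant factors of the abelian
group `K`, that is, `K ≅ ℤ/α₀ ⊕ ⋯ ⊕ ℤ/α_{s-1}`. -/
structure IsInvariantFactors (K : Type*) [AddCommGroup K] {s : ℕ} (α : Fin s → ℕ) : Prop where
  one_lt : ∀ i, 1 < α i
  dvd : ∀ i j, i ≤ j → α i ∣ α j
  equiv : Nonempty (K ≃+ ((i : Fin s) → ZMod (α i)))

/-- The abelian group `K` is a finite abelian group with exactly `s` invariant factors. -/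
def HasNumInvariantFactors (K : Type*) [AddCommGroup K] (s : ℕ) : Prop :=
  ∃ α : Fin s → ℕ, IsInvariantFactors K α

section Trees

variable {V A B : Type u} [Fintype V] [Fintype A] [Fintype B]

open scoped Classical in
/-- The degree of a vertex. -/
noncomputable def vertexDegree (G : SimpleGraph V) (v : V) : ℕ := G.degree v

open scoped Classical in
/-- The number `ℓ(G)` of leaves, i.e. of vertices of degree one. -/
noncomputable def numLeaves (G : SimpleGraph V) : ℕ :=
  (Finset.univ.filter fun v : V => vertexDegree G v = 1).card

/-- A starlike tree is a tree with exactly one vertex of degree at least `3`. -/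
def IsStarlikeTree (S : SimpleGraph V) : Prop :=
  S.IsTree ∧ ∃! c : V, 3 ≤ vertexDegree S c

/-- `v` is a leaf that is adjacent to a vertex of degree at least `3` (in a starlike tree, to the
central vertex). -/
def IsLeafAdjacentToCenter (S : SimpleGraph V) (v : V) : Prop :=
  vertexDegree S v = 1 ∧ ∃ c : V, 3 ≤ vertexDegree S c ∧ S.Adj v c

/-- `G` is obtained from the graphs `G₁` and `G₂` by merging the vertices `x` and `y`: there are
copies of `G₁` and `G₂` in `G` which share exactly the vertex `x = y` and whose union is `G`. -/
def IsMergeOf (G : SimpleGraph V) (G₁ : SimpleGraph A) (x : A) (G₂ : SimpleGraph B) (y : B) :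
    Prop :=
  ∃ (f : A ↪ V) (g : B ↪ V),
    (∀ a b, f a = g b ↔ a = x ∧ b = y) ∧
    (∀ v : V, v ∈ Set.range f ∨ v ∈ Set.range g) ∧
    G = G₁.map f ⊔ G₂.map g

/-- `(S, T', vs, vt)` is a starlike splitting of the tree `T`. -/
structure IsStarlikeSplitting (T : SimpleGraph V) (S : SimpleGraph A) (T' : SimpleGraph B)
    (vs : A) (vt : B) : Prop where
  isTree : T.IsTree
  multiple_high_degree : ∃ v w : V, v ≠ w ∧ 3 ≤ vertexDegree T v ∧ 3 ≤ vertexDegree T w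
  starlike : IsStarlikeTree S
  isTree' : T'.IsTree
  leaf : IsLeafAdjacentToCenter S vs
  merge : IsMergeOf T S vs T' vt

end Trees

/-- A graph on a finite vertex set, bundled with its vertex set. -/
structure FiniteGraph : Type (u + 1) where
  Vertex : Type u
  fintype : Fintype Vertex
  graph : SimpleGraph Vertex

attribute [instance] FiniteGraph.fintype

/-- `IsStarlikeDecomposition T [S₁, …, S_k]`: the collection `S₁, …, S_k` is a starlike
decomposition of the tree `T`, the result of a sequence of starlike splittings that ends with a tree
having at most one vertex of degree at least `3`. -/
inductive IsStarlikeDecomposition :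
    {V : Type u} → [Fintype V] → SimpleGraph V → List FiniteGraph.{u} → Prop
  | single {V : Type u} [Fintype V] (T : SimpleGraph V) (isTree : T.IsTree)
      (high : ∀ v w : V, 3 ≤ vertexDegree T v → 3 ≤ vertexDegree T w → v = w) :
      IsStarlikeDecomposition T [⟨V, inferInstance, T⟩]
  | split {V A B : Type u} [Fintype V] [Fintype A] [Fintype B] (T : SimpleGraph V)
      (S : SimpleGraph A) (T' : SimpleGraph B) (vs : A) (vt : B) (L : List FiniteGraph.{u})
      (splitting : IsStarlikeSplitting T S T' vs vt) (rest : IsStarlikeDecomposition T' L) :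
      IsStarlikeDecomposition T (⟨A, inferInstance, S⟩ :: L)

/-- The sum `∑ᵢ (ℓ(Sᵢ) - 2)` over a collection of finite graphs. -/
noncomputable def leafExcess (L : List FiniteGraph.{u}) : ℤ :=
  (L.map fun S => (numLeaves S.graph : ℤ) - 2).sum

/-! Both halves describe homomorphisms out of the cokernel. Sending each vertex to its class is the
universal function `g` with values in an abelian group satisfying `d v * g v = ∑ w ∼ v, g w` at
every `v` (`isHarmonicAt_vertexClass`, `exists_cokernel_lift`, `cokernel_induction`); call such
functions harmonic.

Upper bound. Let a prime `p` divide all `s` invariant factors. The positive vector `r` supplies a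
nonzero map to `ℤ`, so the cokernel maps onto `(ℤ/p)^(s+1)`, and the `ℤ/p`-valued harmonic functions
contain a space of dimension `s + 1`. If vanishing on a vertex set `Z` forces a harmonic function to
vanish everywhere, then `s + 1 ≤ |Z|`. Such a `Z` with at most `1 + ∑ (ℓᵢ - 2)` vertices is built
along the decomposition (`IsStarlikeDecomposition.exists_zeroForcing`): each split needs one vertex
on all but two arms of its star, one of the two omitted arms being the gluing leaf.

Construction. An arithmetical structure is grown over connected vertex sets `U`, with the cokernel
tracked by its universal property (`IsRealizedOn`). Attaching a leaf leaves the cokernel unchanged.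
Attaching a vertex `c` together with `a + 1` new neighbours multiplies the cokernel by `(ℤ/2)^a` for
suitable diagonal entries (`IsPendantStar.isRealizedOn`). A star with `ℓ` leaves therefore
contributes any `a ≤ ℓ - 2`, and whatever vertices remain are attached as leaves
(`IsRealizedOn.of_pendantStar`, `IsStarlikeDecomposition.isRealizedOn`). -/

/-! ### Invariant factors and reduction modulo a prime -/

/-- By the Chinese remainder theorem, the new prime power can trade places with the `p`-part of the
top factor: the top keeps the larger power, and the smaller one is inserted into the tail. The bound
`m` makes the induction close, since the new top must be divisible by every factor of the new tail.
-/
theorem exists_factorChain_insert {s : ℕ} {p : ℕ} (hp : p.Prime) (α : Fin s → ℕ) (e m : ℕ)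
    (hpos : ∀ i, 0 < α i) (hdvd : ∀ i j, i ≤ j → α j ∣ α i) (hem : p ^ e ∣ m)
    (hαm : ∀ i, α i ∣ m) :
    ∃ β : Fin (s + 1) → ℕ, (∀ i, 0 < β i) ∧ (∀ i j, i ≤ j → β j ∣ β i) ∧ (∀ i, β i ∣ m) ∧
      Nonempty ((ZMod (p ^ e) × ((i : Fin s) → ZMod (α i))) ≃+ ((i : Fin (s + 1)) → ZMod (β i))) := by
  induction s generalizing e m with
  | zero =>
    refine ⟨fun _ => p ^ e, fun _ => pow_pos hp.pos _, fun _ _ _ => dvd_rfl, fun _ => hem, ⟨?_⟩⟩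
    exact (AddEquiv.prodUnique (M := ZMod (p ^ e)) (N := (i : Fin 0) → ZMod (α i))).trans
      (AddEquiv.piUnique (fun _ : Fin 1 => ZMod (p ^ e))).symm
  | succ s ih =>
    obtain ⟨f, k, hk, hα0⟩ := Nat.exists_eq_pow_mul_and_not_dvd (hpos 0).ne' p hp.ne_one
    have hcop : ∀ n, Nat.Coprime (p ^ n) k := fun n =>
      Nat.Coprime.pow_left n ((Nat.Prime.coprime_iff_not_dvd hp).2 hk)
    have hk0 : 0 < k := Nat.pos_of_ne_zero fun h => hk (h ▸ dvd_zero p)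
    have swap : Nonempty ((ZMod (p ^ e) × ZMod (α 0)) ≃+
        (ZMod (p ^ max e f * k) × ZMod (p ^ min e f))) := by
      rw [hα0]
      rcases le_total e f with h | h
      · rw [max_eq_right h, min_eq_left h]
        exact ⟨AddEquiv.prodComm⟩
      · rw [max_eq_left h, min_eq_right h]
        refine ⟨(AddEquiv.prodCongr (AddEquiv.refl _)
          ((ZMod.chineseRemainder (hcop f)).toAddEquiv.trans AddEquiv.prodComm)).trans ?_⟩
        exact AddEquiv.prodAssoc.symm.trans
          (AddEquiv.prodCongr (ZMod.chineseRemainder (hcop e)).symm.toAddEquiv (AddEquiv.refl _))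
    obtain ⟨β, hβpos, hβdvd, hβm, ⟨E⟩⟩ := ih (fun i => α i.succ) (min e f) (p ^ max e f * k)
      (fun i => hpos _) (fun i j hij => hdvd _ _ (Fin.succ_le_succ_iff.2 hij))
      (Dvd.dvd.mul_right (pow_dvd_pow p (min_le_max)) k)
      (fun i => (hdvd 0 i.succ (Fin.zero_le _)).trans
        (hα0 ▸ Nat.mul_dvd_mul_right (pow_dvd_pow p (le_max_right e f)) k))
    have htop : p ^ max e f * k ∣ m := by
      refine Nat.Coprime.mul_dvd_of_dvd_of_dvd (hcop _) ?_
        ((Dvd.intro_left _ rfl : k ∣ p ^ f * k).trans (hα0 ▸ hαm 0))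
      rcases le_total e f with h | h
      · rw [max_eq_right h]
        exact (Dvd.intro _ rfl : p ^ f ∣ p ^ f * k).trans (hα0 ▸ hαm 0)
      · rwa [max_eq_left h]
    refine ⟨Fin.cons (p ^ max e f * k) β, ?_, ?_, ?_, ?_⟩
    · intro i
      refine Fin.cases ?_ (fun i => ?_) i
      · exact Nat.mul_pos (pow_pos hp.pos _) hk0
      · exact hβpos i
    · intro i j
      refine Fin.cases ?_ (fun i => ?_) i <;> refine Fin.cases ?_ (fun j => ?_) j
      · exact fun _ => dvd_rfl
      · exact fun _ => hβm j
      · exact fun h => absurd h (by simp)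
      · exact fun h => hβdvd i j (Fin.succ_le_succ_iff.1 h)
    · intro i
      refine Fin.cases htop (fun i => ?_) i
      exact (hβm i).trans htop
    · obtain ⟨sw⟩ := swap
      let c1 := (Fin.consLinearEquiv ℤ (fun i : Fin (s + 1) => ZMod (α i))).toAddEquiv
      let c2 := (Fin.consLinearEquiv ℤ (fun i : Fin (s + 2) =>
        ZMod ((Fin.cons (p ^ max e f * k) β : Fin (s + 2) → ℕ) i))).toAddEquiv
      refine ⟨(AddEquiv.prodCongr (AddEquiv.refl _) c1.symm).trans (AddEquiv.trans ?_ c2)⟩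
      refine AddEquiv.prodAssoc.symm.trans ((AddEquiv.prodCongr sw (AddEquiv.refl _)).trans ?_)
      exact AddEquiv.prodAssoc.trans (AddEquiv.prodCongr (AddEquiv.refl _) E)

theorem exists_factorChain {n : ℕ} (p e : Fin n → ℕ) (hp : ∀ i, (p i).Prime) :
    ∃ β : Fin n → ℕ, (∀ i, 0 < β i) ∧ (∀ i j, i ≤ j → β j ∣ β i) ∧
      Nonempty (((i : Fin n) → ZMod (p i ^ e i)) ≃+ ((i : Fin n) → ZMod (β i))) := by
  induction n with
  | zero => exact ⟨fun _ => 1, by simp, by simp, ⟨AddEquiv.ofUnique⟩⟩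
  | succ n ih =>
    obtain ⟨α, hpos, hdvd, ⟨E⟩⟩ := ih (fun i => p i.succ) (fun i => e i.succ) fun i => hp _
    -- The bound `m = 0` is divisible by everything and so imposes no constraint.
    obtain ⟨β, hβpos, hβdvd, -, ⟨E'⟩⟩ := exists_factorChain_insert (hp 0) α (e 0) 0 hpos hdvd
      (dvd_zero _) (fun _ => dvd_zero _)
    refine ⟨β, hβpos, hβdvd, ⟨AddEquiv.trans ?_ E'⟩⟩
    exact (Fin.consLinearEquiv ℤ (fun i => ZMod (p i ^ e i))).toAddEquiv.symm.trans
      (AddEquiv.prodCongr (AddEquiv.refl _) E)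

/-- In an increasing divisibility chain the factors equal to `1` come first and contribute trivial
groups, so they can be stripped from the front. -/
theorem exists_hasNumInvariantFactors_of_chain {n : ℕ} {K : Type*} [AddCommGroup K]
    (γ : Fin n → ℕ) (hpos : ∀ i, 0 < γ i) (hdvd : ∀ i j, i ≤ j → γ i ∣ γ j)
    (E : K ≃+ ((i : Fin n) → ZMod (γ i))) : ∃ s, HasNumInvariantFactors K s := by
  induction n with
  | zero => exact ⟨0, γ, fun i => i.elim0, hdvd, ⟨E⟩⟩
  | succ n ih =>
    by_cases h : γ 0 = 1
    · refine ih (fun i => γ i.succ) (fun i => hpos _)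
        (fun i j hij => hdvd _ _ (Fin.succ_le_succ_iff.2 hij)) (E.trans ?_)
      have : Unique (ZMod (γ 0)) := by
        rw [h]; exact ⟨⟨0⟩, fun a => Subsingleton.elim _ _⟩
      exact (Fin.consLinearEquiv ℤ (fun i => ZMod (γ i))).toAddEquiv.symm.trans AddEquiv.uniqueProd
    · exact ⟨n + 1, γ, fun i => (show 1 < γ 0 by have := hpos 0; omega).trans_le
        (Nat.le_of_dvd (hpos i) (hdvd 0 i (Fin.zero_le _))), hdvd, ⟨E⟩⟩

theorem exists_hasNumInvariantFactors_of_finite (K : Type*) [AddCommGroup K] [Finite K] :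
    ∃ s, HasNumInvariantFactors K s := by
  obtain ⟨ι, _, p, hp, e, ⟨E⟩⟩ := AddCommGroup.equiv_directSum_zmod_of_finite K
  classical
  let σ := Fintype.equivFin ι
  obtain ⟨β, hpos, hdvd, ⟨E'⟩⟩ := exists_factorChain (fun i => p (σ.symm i)) (fun i => e (σ.symm i))
    fun i => hp _
  let E1 := (DirectSum.addEquivProd fun i => ZMod (p i ^ e i))
  let E2 := (LinearEquiv.piCongrLeft' ℤ (fun i => ZMod (p i ^ e i)) σ).toAddEquiv
  -- Insertion produces a decreasing chain; reversing the index makes it increasing.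
  let E3 := (LinearEquiv.piCongrLeft' ℤ (fun i => ZMod (β i)) Fin.revPerm).toAddEquiv
  refine exists_hasNumInvariantFactors_of_chain (fun i => β (Fin.revPerm.symm i)) (fun i => hpos _)
    (fun i j hij => hdvd _ _ ?_) (E.trans (E1.trans (E2.trans (E'.trans E3))))
  simpa using hij

/-- The torsion part splits off. It maps onto `(ℤ/p)^s` because `p` divides every factor, while `ρ`,
which kills torsion, witnesses that the free quotient has positive rank and yields one more copy of
`ℤ/p`. -/
theorem exists_surjective_torsion_reduction {C : Type*} [AddCommGroup C] [Module.Finite ℤ C] {s : ℕ}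
    (p : ℕ) (ρ : C →+ ℤ) (hρ : ρ ≠ 0) (α : Fin s → ℕ) (hα : ∀ i, p ∣ α i)
    (E : Submodule.torsion ℤ C ≃+ ((i : Fin s) → ZMod (α i))) :
    ∃ φ : C →+ (Fin s → ZMod p) × ZMod p, Function.Surjective φ := by
  obtain ⟨n, ⟨b⟩⟩ := @Module.basisOfFiniteTypeTorsionFree' ℤ _ (C ⧸ Submodule.torsion ℤ C) _ _ _ _ _ _
  have hn : 0 < n := by
    by_contra hn
    obtain rfl : n = 0 := by omega
    refine hρ (AddMonoidHom.ext fun x => ?_)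
    have hx : (Submodule.torsion ℤ C).mkQ x = 0 := b.injective (Subsingleton.elim _ _)
    rw [Submodule.mkQ_apply, Submodule.Quotient.mk_eq_zero, Submodule.mem_torsion_iff] at hx
    obtain ⟨a, ha⟩ := hx
    have h2 : (a : ℤ) • ρ x = 0 := by rw [← map_zsmul]; exact (congrArg ρ ha).trans (map_zero ρ)
    simpa using h2
  obtain ⟨f, hf⟩ := Module.projective_lifting_property _ LinearMap.id
    (Submodule.torsion ℤ C).mkQ_surjective
  let D := (lequivProdOfRightSplitExact (Submodule.torsion ℤ C).injective_subtype
    (by rw [Submodule.range_subtype, Submodule.ker_mkQ]) hf).symm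
  let A' : ((i : Fin s) → ZMod (α i)) →+ (Fin s → ZMod p) :=
    AddMonoidHom.mk' (fun x i => ZMod.castHom (hα i) (ZMod p) (x i))
      (fun x y => funext fun i => map_add (ZMod.castHom (hα i) (ZMod p)) (x i) (y i))
  have hA' : Function.Surjective A' := by
    intro y
    choose g hg using fun i => ZMod.castHom_surjective (hα i) (y i)
    exact ⟨g, funext hg⟩
  let A : (Submodule.torsion ℤ C) →+ (Fin s → ZMod p) := A'.comp E.toAddMonoidHom
  have hA : Function.Surjective A := hA'.comp E.surjective
  let B : (C ⧸ Submodule.torsion ℤ C) →+ ZMod p :=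
    ((Int.castAddHom (ZMod p)).comp (Finsupp.applyAddHom (⟨0, hn⟩ : Fin n))).comp b.toAddMonoidHom
  have hB : Function.Surjective B := by
    intro y
    obtain ⟨z, rfl⟩ := ZMod.intCast_surjective y
    exact ⟨b.symm (Finsupp.single ⟨0, hn⟩ z), by simp [B]⟩
  refine ⟨(A.prodMap B).comp D.toAddMonoidHom, ?_⟩
  exact (Prod.map_surjective.2 ⟨hA, hB⟩).comp D.surjective

/-! ### Harmonic functions on starlike trees and leaf counts -/

section Harmonic

variable {V : Type u} [Fintype V] {N : Type*} [AddCommGroup N]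

open scoped Classical in
/-- The equation `d v * g v = ∑ w ∼ v, g w` at the vertex `v`. -/
def IsHarmonicAt (G : SimpleGraph V) (d : V → ℤ) (g : V → N) (v : V) : Prop :=
  d v • g v = ∑ w with G.Adj v w, g w

open scoped Classical in
theorem vertexDegree_eq_card (G : SimpleGraph V) (v : V) :
    vertexDegree G v = (Finset.univ.filter (G.Adj v)).card := by
  rw [vertexDegree, ← SimpleGraph.card_neighborFinset_eq_degree]
  congr 1
  ext w; simp

open scoped Classical in
theorem IsHarmonicAt.eq_zero_of_forall_ne {G : SimpleGraph V} {d : V → ℤ} {g : V → N} {v u : V}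
    (h : IsHarmonicAt G d g v) (hv : g v = 0) (hu : G.Adj v u)
    (hz : ∀ w, G.Adj v w → w ≠ u → g w = 0) : g u = 0 := by
  rw [IsHarmonicAt, hv, smul_zero, Finset.sum_eq_single u] at h
  · exact h.symm
  · intro w hw hwu
    exact hz w (by simpa using hw) hwu
  · intro hu'
    exact absurd hu (by simpa using hu')

theorem eq_or_eq_of_vertexDegree_le_two {G : SimpleGraph V} {z y y' w : V}
    (hz : vertexDegree G z ≤ 2) (hy : G.Adj z y) (hy' : G.Adj z y') (hne : y ≠ y')
    (hw : G.Adj z w) : w = y ∨ w = y' := by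
  classical
  by_contra! h
  rw [vertexDegree_eq_card] at hz
  have : ({w, y, y'} : Finset V) ⊆ Finset.univ.filter (G.Adj z) := by
    intro a ha
    simp only [Finset.mem_insert, Finset.mem_singleton] at ha
    rcases ha with rfl | rfl | rfl <;> simpa
  have h3 : ({w, y, y'} : Finset V).card = 3 := by
    rw [Finset.card_eq_three]
    exact ⟨w, y, y', h.1, h.2, hne, rfl⟩
  have := Finset.card_le_card this
  omega

theorem IsHarmonicAt.eq_zero_of_vertexDegree_le_two {G : SimpleGraph V} {d : V → ℤ} {g : V → N}
    {z y y' : V} (h : IsHarmonicAt G d g z) (hdeg : vertexDegree G z ≤ 2)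
    (hy : G.Adj z y) (hy' : G.Adj z y') (hne : y ≠ y') (hz0 : g z = 0) (hy0 : g y = 0) :
    g y' = 0 :=
  h.eq_zero_of_forall_ne hz0 hy' fun w hw hwy' => by
    rcases eq_or_eq_of_vertexDegree_le_two hdeg hy hy' hne hw with rfl | rfl
    · exact hy0
    · exact absurd rfl hwy'

/-- Outward propagation from the centre of a starlike graph; the vertices in `P` are exempt. -/
theorem eq_zero_of_center_eq_zero {G : SimpleGraph V} (hG : G.Connected) {c : V} {P : V → Prop}
    (hP : ∀ a, P a → ∀ b, G.Adj a b → b = c) (hdeg : ∀ a, a ≠ c → vertexDegree G a ≤ 2)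
    {d : V → ℤ} {g : V → N} (hg : ∀ a, a ≠ c → ¬ P a → IsHarmonicAt G d g a)
    (hc : g c = 0) (hnc : ∀ u, G.Adj c u → g u = 0) (v : V) : g v = 0 := by
  -- Vanishing must be carried for a vertex and all its neighbours: the equation at a vertex of
  -- degree at most two needs two known consecutive values to yield the next.
  have key : ∀ v, G.Reachable c v → g v = 0 ∧ ∀ u, G.Adj v u → g u = 0 := by
    intro v hv
    rw [SimpleGraph.reachable_iff_reflTransGen] at hv
    induction hv with
    | refl => exact ⟨hc, hnc⟩
    | @tail y z _ hyz ih =>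
      refine ⟨ih.2 z hyz, fun u hu => ?_⟩
      by_cases hzc : z = c
      · subst hzc; exact hnc u hu
      by_cases huy : y = u
      · subst huy; exact ih.1
      by_cases hPz : P z
      · rw [hP z hPz u hu]; exact hc
      exact (hg z hzc hPz).eq_zero_of_vertexDegree_le_two (hdeg z hzc) hyz.symm hu huy
        (ih.2 z hyz) ih.1
  exact (key v (hG c v)).1

/-- Inward propagation: along the arm of a starlike tree that starts with the end of the path `p`
there is a vertex at which the vanishing of a harmonic function forces it to vanish along `p`. -/
theorem exists_forcing_vertex_of_path {G : SimpleGraph V} (hG : G.IsAcyclic) {c : V} {P : V → Prop}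
    (hP : ∀ a, P a → ∀ b, G.Adj a b → b = c) (hdeg : ∀ a, a ≠ c → vertexDegree G a ≤ 2)
    (n : ℕ) : ∀ (y z : V) (p : G.Walk c y) (h : G.Adj y z), (p.concat h).IsPath →
      Fintype.card V ≤ n + p.length → ¬ P z →
      ∃ w, ∀ (d : V → ℤ) (g : V → N), (∀ a, a ≠ c → ¬ P a → IsHarmonicAt G d g a) →
        g w = 0 → g y = 0 ∧ g z = 0 := by
  induction n with
  | zero =>
    intro y z p h hp hn _
    have := hp.length_lt
    rw [SimpleGraph.Walk.length_concat] at this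
    omega
  | succ n ih =>
    intro y z p h hp hn hPz
    have hzc : z ≠ c := by
      rintro rfl
      rw [SimpleGraph.Walk.concat_isPath_iff] at hp
      exact hp.2 p.start_mem_support
    -- At the end of the arm, one zero forces the second through the leaf equation; otherwise the
    -- path is lengthened. The number `n` is fuel, exhausted when the path would need more than
    -- `|V|` vertices.
    by_cases hleaf : ∀ b, G.Adj z b → b = y
    · refine ⟨z, fun d g hg hz => ⟨?_, hz⟩⟩
      exact (hg z hzc hPz).eq_zero_of_forall_ne hz h.symm fun w hw hwy => absurd (hleaf w hw) hwy
    · push Not at hleaf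
      obtain ⟨z', hz', hne⟩ := hleaf
      have hq : ((p.concat h).concat hz').IsPath := by
        refine hp.concat (fun hmem => hne ?_) hz'
        rw [hG.eq_penultimate_of_adj_end hp hz' hmem, SimpleGraph.Walk.penultimate_concat]
      have hPz' : ¬ P z' := fun h' => hzc (hP z' h' z hz'.symm)
      obtain ⟨w, hw⟩ := ih z z' (p.concat h) hz' hq
        (by rw [SimpleGraph.Walk.length_concat]; omega) hPz'
      refine ⟨w, fun d g hg hgw => ?_⟩
      obtain ⟨h1, h2⟩ := hw d g hg hgw
      exact ⟨(hg z hzc hPz).eq_zero_of_vertexDegree_le_two (hdeg z hzc) hz' h.symm hne h1 h2, h1⟩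

theorem exists_forcing_vertex {G : SimpleGraph V} (hG : G.IsAcyclic) {c : V} {P : V → Prop}
    (hP : ∀ a, P a → ∀ b, G.Adj a b → b = c) (hdeg : ∀ a, a ≠ c → vertexDegree G a ≤ 2)
    {u : V} (hu : G.Adj c u) (hPu : ¬ P u) :
    ∃ w, ∀ (d : V → ℤ) (g : V → N), (∀ a, a ≠ c → ¬ P a → IsHarmonicAt G d g a) →
        g w = 0 → g c = 0 ∧ g u = 0 :=
  exists_forcing_vertex_of_path hG hP hdeg (Fintype.card V) c u SimpleGraph.Walk.nil hu
    (by simp [SimpleGraph.Walk.concat, hu.ne]) (by simp) hPu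

/-- Handshake lemma combined with `|E| = |V| - 1`. A leaf contributes `1` and a vertex of degree two
contributes `0`, which is how leaves are counted below. -/
theorem sum_two_sub_vertexDegree {G : SimpleGraph V} (hG : G.IsTree) :
    ∑ v, ((2 : ℤ) - vertexDegree G v) = 2 := by
  classical
  have h1 := G.sum_degrees_eq_twice_card_edges
  have h2 := hG.card_edgeFinset
  have h3 : ∑ v, (vertexDegree G v : ℤ) = 2 * (G.edgeFinset.card : ℤ) := by
    rw [← Nat.cast_sum]
    have : ∑ v, vertexDegree G v = 2 * G.edgeFinset.card := by
      rw [← h1]; unfold vertexDegree; congr!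
    rw [this]; push_cast; rfl
  rw [Finset.sum_sub_distrib, h3]
  simp only [Finset.sum_const, Finset.card_univ, nsmul_eq_mul]
  rw [← h2]; push_cast; ring

theorem one_le_vertexDegree {G : SimpleGraph V} (hG : G.Connected) (hV : 2 ≤ Fintype.card V)
    (v : V) : 1 ≤ vertexDegree G v := by
  classical
  have : Nontrivial V := Fintype.one_lt_card_iff_nontrivial.1 hV
  obtain ⟨w, hw⟩ := hG.preconnected.exists_adj_of_nontrivial v
  rw [vertexDegree_eq_card]
  exact Finset.card_pos.2 ⟨w, by simpa using hw⟩

theorem numLeaves_eq_two {G : SimpleGraph V} (hG : G.IsTree) (hV : 2 ≤ Fintype.card V)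
    (hdeg : ∀ v, vertexDegree G v ≤ 2) : numLeaves G = 2 := by
  classical
  have h := sum_two_sub_vertexDegree hG
  have h2 : ∀ v, (2 : ℤ) - vertexDegree G v = if vertexDegree G v = 1 then 1 else 0 := by
    intro v
    have := one_le_vertexDegree hG.1 hV v
    have := hdeg v
    split_ifs <;> omega
  simp only [h2, Finset.sum_boole] at h
  unfold numLeaves
  convert Nat.cast_injective h

theorem numLeaves_eq_vertexDegree {G : SimpleGraph V} (hG : G.IsTree) {c : V}
    (hc : 3 ≤ vertexDegree G c) (hdeg : ∀ v, v ≠ c → vertexDegree G v ≤ 2) :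
    numLeaves G = vertexDegree G c := by
  classical
  have hV : 2 ≤ Fintype.card V := by
    rw [vertexDegree_eq_card] at hc
    have := Finset.card_le_univ (Finset.univ.filter (G.Adj c))
    omega
  have h := sum_two_sub_vertexDegree hG
  have h2 : ∀ v, (2 : ℤ) - vertexDegree G v =
      (if vertexDegree G v = 1 then 1 else 0) + if v = c then 2 - (vertexDegree G c : ℤ) else 0 := by
    intro v
    by_cases hv : v = c
    · subst hv
      rw [if_neg (by omega), if_pos rfl]; omega
    have := one_le_vertexDegree hG.1 hV v
    have := hdeg v hv
    rw [if_neg hv]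
    split_ifs <;> omega
  rw [Finset.sum_congr rfl fun v _ => h2 v] at h
  simp only [Finset.sum_boole, Finset.sum_add_distrib, Finset.sum_ite_eq', Finset.mem_univ,
    if_true] at h
  have h3 : numLeaves G = (Finset.univ.filter fun v : V => vertexDegree G v = 1).card := by
    unfold numLeaves; congr!
  rw [h3]
  omega

end Harmonic

/-! ### Gluing two trees at a vertex -/

section Merge

variable {V A B : Type u} {N : Type*} [AddCommGroup N]

/-- An equation in the large graph restricts to the piece as soon as the function vanishes on the
neighbours lying outside it. -/
theorem IsHarmonicAt.comp_embedding [Fintype V] [Fintype A] {T : SimpleGraph V}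
    {G : SimpleGraph A} {d : V → ℤ} {h : V → N}
    (φ : A ↪ V) {a : A} (hT : IsHarmonicAt T d h (φ a))
    (hadj : ∀ a', G.Adj a a' → T.Adj (φ a) (φ a'))
    (hrest : ∀ w, T.Adj (φ a) w → (∃ a', G.Adj a a' ∧ φ a' = w) ∨ h w = 0) :
    IsHarmonicAt G (d ∘ φ) (h ∘ φ) a := by
  classical
  unfold IsHarmonicAt at hT ⊢
  simp only [Function.comp_apply]
  rw [hT, ← Finset.sum_map (Finset.univ.filter (G.Adj a)) φ h]
  symm
  convert Finset.sum_subset (s₁ := (Finset.univ.filter (G.Adj a)).map φ)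
    (s₂ := Finset.univ.filter (T.Adj (φ a))) (f := h) ?_ ?_
  · intro w hw
    simp only [Finset.mem_map, Finset.mem_filter, Finset.mem_univ, true_and] at hw ⊢
    obtain ⟨a', ha', rfl⟩ := hw
    exact hadj a' ha'
  · intro w hw hw'
    simp only [Finset.mem_map, Finset.mem_filter, Finset.mem_univ, true_and] at hw hw'
    exact (hrest w hw).resolve_left hw'

/-- The data of a merge of the graphs `S` and `T'` at the vertices `x` and `y`. -/
structure IsMerge (T : SimpleGraph V) (S : SimpleGraph A) (x : A) (T' : SimpleGraph B) (y : B)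
    (f : A ↪ V) (g : B ↪ V) : Prop where
  eq_iff : ∀ a b, f a = g b ↔ a = x ∧ b = y
  cover : ∀ v : V, v ∈ Set.range f ∨ v ∈ Set.range g
  eq_sup : T = S.map f ⊔ T'.map g

namespace IsMerge

variable {T : SimpleGraph V} {S : SimpleGraph A} {x : A} {T' : SimpleGraph B} {y : B}
  {f : A ↪ V} {g : B ↪ V}

theorem adj_left (hm : IsMerge T S x T' y f g) {a a' : A} (h : S.Adj a a') : T.Adj (f a) (f a') := by
  rw [hm.eq_sup]; exact Or.inl (by simpa using h)

theorem adj_right (hm : IsMerge T S x T' y f g) {b b' : B} (h : T'.Adj b b') : T.Adj (g b) (g b') := by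
  rw [hm.eq_sup]; exact Or.inr (by simpa using h)

theorem of_adj (hm : IsMerge T S x T' y f g) {v w : V} (h : T.Adj v w) :
    (∃ a a', S.Adj a a' ∧ f a = v ∧ f a' = w) ∨ ∃ b b', T'.Adj b b' ∧ g b = v ∧ g b' = w := by
  rw [hm.eq_sup] at h
  rcases h with h | h
  · exact Or.inl ((SimpleGraph.map_adj _ _ _ _).1 h)
  · exact Or.inr ((SimpleGraph.map_adj _ _ _ _).1 h)

theorem apply_eq (hm : IsMerge T S x T' y f g) : f x = g y := (hm.eq_iff x y).2 ⟨rfl, rfl⟩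

theorem adj_left_of_ne (hm : IsMerge T S x T' y f g) {a : A} (ha : a ≠ x) {w : V} (h : T.Adj (f a) w) :
    ∃ a', S.Adj a a' ∧ f a' = w := by
  rcases hm.of_adj h with ⟨a₁, a', h1, h2, h3⟩ | ⟨b, b', -, h2, -⟩
  · obtain rfl := f.injective h2
    exact ⟨a', h1, h3⟩
  · exact absurd ((hm.eq_iff a b).1 h2.symm).1 ha

theorem adj_right_or (hm : IsMerge T S x T' y f g) {b : B} {w : V} (h : T.Adj (g b) w) :
    (∃ b', T'.Adj b b' ∧ g b' = w) ∨ ∃ a', S.Adj x a' ∧ f a' = w := by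
  rcases hm.of_adj h with ⟨a, a', h1, h2, h3⟩ | ⟨b₁, b', h1, h2, h3⟩
  · obtain ⟨rfl, rfl⟩ := (hm.eq_iff a b).1 h2
    exact Or.inr ⟨a', h1, h3⟩
  · obtain rfl := g.injective h2
    exact Or.inl ⟨b', h1, h3⟩

theorem of_adj_right (hm : IsMerge T S x T' y f g) {b b' : B} (h : T.Adj (g b) (g b')) : T'.Adj b b' := by
  rcases hm.adj_right_or h with ⟨b₁, h1, h2⟩ | ⟨a', h1, h2⟩
  · rwa [g.injective h2] at h1
  · obtain ⟨rfl, -⟩ := (hm.eq_iff _ _).1 h2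
    exact absurd h1 (SimpleGraph.irrefl _)

theorem vertexDegree_left_of_subsingleton [Fintype V] [Fintype A] [Subsingleton B]
    (hm : IsMerge T S x T' y f g) (a : A) :
    vertexDegree T (f a) = vertexDegree S a := by
  classical
  rw [vertexDegree_eq_card, vertexDegree_eq_card, ← Finset.card_map f]
  congr 1
  ext w
  simp only [Finset.mem_map, Finset.mem_filter, Finset.mem_univ, true_and]
  constructor
  · intro h
    rcases hm.of_adj h with ⟨a₁, a', h1, h2, h3⟩ | ⟨b, b', h1, -, -⟩
    · obtain rfl := f.injective h2
      exact ⟨a', h1, h3⟩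
    · exact absurd (Subsingleton.elim b b') h1.ne
  · rintro ⟨a', h, rfl⟩
    exact hm.adj_left h

end IsMerge

/-- If `T'` were a single vertex, `T` would be a copy of `S` and have only one vertex of degree at
least three. -/
theorem IsStarlikeSplitting.two_le_card [Fintype V] [Fintype A] [Fintype B]
    {T : SimpleGraph V} {S : SimpleGraph A} {x : A}
    {T' : SimpleGraph B} {y : B} (h : IsStarlikeSplitting T S T' x y) : 2 ≤ Fintype.card B := by
  by_contra hB
  obtain ⟨f, g, h1, h2, h3⟩ := h.merge
  have hm : IsMerge T S x T' y f g := ⟨h1, h2, h3⟩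
  have : Subsingleton B := Fintype.card_le_one_iff_subsingleton.1 (by omega)
  have hf : ∀ v, ∃ a, f a = v := by
    intro v
    rcases h2 v with ⟨a, ha⟩ | ⟨b, hb⟩
    · exact ⟨a, ha⟩
    · exact ⟨x, by rw [hm.apply_eq, ← hb, Subsingleton.elim y b]⟩
  obtain ⟨v, w, hne, hv, hw⟩ := h.multiple_high_degree
  obtain ⟨a, rfl⟩ := hf v
  obtain ⟨b, rfl⟩ := hf w
  rw [hm.vertexDegree_left_of_subsingleton] at hv hw
  exact hne (congrArg f (h.starlike.2.unique hv hw))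

/-- The central vertex of the starlike tree of a splitting. -/
theorem IsStarlikeSplitting.exists_center [Fintype V] [Fintype A]
    {T : SimpleGraph V} {S : SimpleGraph A} {x : A}
    {T' : SimpleGraph B} {y : B} (h : IsStarlikeSplitting T S T' x y) :
    ∃ c, c ≠ x ∧ S.Adj x c ∧ (∀ a, S.Adj x a → a = c) ∧ (∀ a, a ≠ c → vertexDegree S a ≤ 2) ∧
      3 ≤ vertexDegree S c ∧ numLeaves S = vertexDegree S c := by
  classical
  obtain ⟨hx, c, hc, hxc⟩ := h.leaf
  have hdeg : ∀ a, a ≠ c → vertexDegree S a ≤ 2 := by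
    intro a ha
    by_contra h3
    exact ha (h.starlike.2.unique (by omega) hc)
  refine ⟨c, hxc.ne', hxc, fun a ha => ?_, hdeg, hc, numLeaves_eq_vertexDegree h.starlike.1 hc hdeg⟩
  rw [vertexDegree_eq_card, Finset.card_eq_one] at hx
  obtain ⟨z, hz⟩ := hx
  have h1 : a ∈ ({z} : Finset A) := by rw [← hz]; simpa using ha
  have h2 : c ∈ ({z} : Finset A) := by rw [← hz]; simpa using hxc
  rw [Finset.mem_singleton] at h1 h2
  rw [h1, h2]

end Merge

/-! ### Small vertex sets that force harmonic functions to vanish -/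

section ZeroForcing

variable {V : Type u} [Fintype V] (N : Type*) [AddCommGroup N]

/-- One forcing vertex is taken on each arm starting in `J`; nonemptiness of `J` is what makes the
centre vanish. The predicate `P` exempts the gluing leaf, whose equation in the whole tree has terms
from outside the star. -/
theorem exists_forcing_finset {G : SimpleGraph V} (hG : G.IsAcyclic) {c : V} {P : V → Prop}
    (hP : ∀ a, P a → ∀ b, G.Adj a b → b = c) (hdeg : ∀ a, a ≠ c → vertexDegree G a ≤ 2)
    (J : Finset V) (hJ : J.Nonempty) (hadj : ∀ u ∈ J, G.Adj c u) (hPJ : ∀ u ∈ J, ¬ P u) :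
    ∃ Z : Finset V, Z.card ≤ J.card ∧ ∀ (d : V → ℤ) (g : V → N),
      (∀ a, a ≠ c → ¬ P a → IsHarmonicAt G d g a) → (∀ z ∈ Z, g z = 0) →
        g c = 0 ∧ ∀ u ∈ J, g u = 0 := by
  classical
  have : ∀ u : J, ∃ w, ∀ (d : V → ℤ) (g : V → N), (∀ a, a ≠ c → ¬ P a → IsHarmonicAt G d g a) →
        g w = 0 → g c = 0 ∧ g u = 0 := fun u =>
    exists_forcing_vertex hG hP hdeg (hadj u u.2) (hPJ u u.2)
  choose w hw using this
  refine ⟨Finset.univ.image w, Finset.card_image_le.trans (by simp), fun d g hg hz => ?_⟩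
  have h := fun u : J => hw u d g hg (hz _ (Finset.mem_image_of_mem w (Finset.mem_univ u)))
  obtain ⟨u, hu⟩ := hJ
  exact ⟨(h ⟨u, hu⟩).1, fun u hu => (h ⟨u, hu⟩).2⟩

/-- The arm through `u` needs no vertex of its own: its first value is determined by the equation at
the centre. -/
theorem exists_zeroForcing_of_starlike {T : SimpleGraph V} (hT : T.IsTree) {c u : V}
    (hcu : T.Adj c u) (hdeg : ∀ v, v ≠ c → vertexDegree T v ≤ 2) (hc : 2 ≤ vertexDegree T c) :
    ∃ Z : Finset V, Z.card + 1 ≤ vertexDegree T c ∧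
      ∀ (d : V → ℤ) (g : V → N), (∀ v, IsHarmonicAt T d g v) → (∀ z ∈ Z, g z = 0) →
        ∀ v, g v = 0 := by
  classical
  have hu : u ∈ Finset.univ.filter (T.Adj c) := by simpa using hcu
  have hcard : ((Finset.univ.filter (T.Adj c)).erase u).card + 1 = vertexDegree T c := by
    rw [vertexDegree_eq_card]
    exact Finset.card_erase_add_one hu
  obtain ⟨Z, hZ, hforce⟩ := exists_forcing_finset N hT.2 (c := c) (P := fun _ => False)
    (fun _ h => h.elim) hdeg ((Finset.univ.filter (T.Adj c)).erase u)
    (Finset.card_pos.1 (by omega)) (fun w hw => by simp at hw; exact hw.2) (fun _ _ h => h)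
  refine ⟨Z, by omega, fun d g hg hz => ?_⟩
  obtain ⟨h0, hJ⟩ := hforce d g (fun a _ _ => hg a) hz
  have hnb : ∀ w, T.Adj c w → w ≠ u → g w = 0 := fun w hw hwu => hJ w (by simp [hw, hwu])
  have hu0 := (hg c).eq_zero_of_forall_ne h0 hcu hnb
  refine eq_zero_of_center_eq_zero hT.1 (P := fun _ => False) (fun _ h => h.elim) hdeg
    (fun a _ _ => hg a) h0 fun w hw => ?_
  by_cases hwu : w = u
  · rw [hwu]; exact hu0
  · exact hnb w hw hwu

theorem exists_zeroForcing_of_path {T : SimpleGraph V} (hT : T.IsTree) (hV : 2 ≤ Fintype.card V)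
    (hdeg : ∀ v, vertexDegree T v ≤ 2) :
    ∃ Z : Finset V, Z.card ≤ 1 ∧
      ∀ (d : V → ℤ) (g : V → N), (∀ v, IsHarmonicAt T d g v) → (∀ z ∈ Z, g z = 0) →
        ∀ v, g v = 0 := by
  classical
  have hl := numLeaves_eq_two hT hV hdeg
  obtain ⟨c, hc⟩ : ∃ c, vertexDegree T c = 1 := by
    unfold numLeaves at hl
    obtain ⟨c, hc⟩ := Finset.card_pos.1 (hl.symm ▸ Nat.two_pos)
    exact ⟨c, (Finset.mem_filter.1 hc).2⟩
  rw [vertexDegree_eq_card, Finset.card_eq_one] at hc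
  obtain ⟨u, hu⟩ := hc
  have hadj : ∀ w, T.Adj c w ↔ w = u := fun w => by
    have := Finset.ext_iff.1 hu w
    simpa using this
  refine ⟨{c}, by simp, fun d g hg hz => ?_⟩
  have h0 := hz c (by simp)
  have hu0 := (hg c).eq_zero_of_forall_ne h0 ((hadj u).2 rfl) fun w hw hwu =>
    absurd ((hadj w).1 hw) hwu
  refine eq_zero_of_center_eq_zero hT.1 (P := fun _ => False) (fun _ h => h.elim)
    (fun v _ => hdeg v) (fun a _ _ => hg a) h0 fun w hw => ?_
  rw [(hadj w).1 hw]; exact hu0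

theorem IsStarlikeDecomposition.exists_zeroForcing {T : SimpleGraph V} {L : List FiniteGraph.{u}}
    (hL : IsStarlikeDecomposition T L) (hV : 2 ≤ Fintype.card V) :
    ∃ Z : Finset V, (Z.card : ℤ) ≤ 1 + leafExcess L ∧
      ∀ (d : V → ℤ) (g : V → N), (∀ v, IsHarmonicAt T d g v) → (∀ z ∈ Z, g z = 0) →
        ∀ v, g v = 0 := by
  classical
  induction hL with
  | @single V _ T hT high =>
    have hex : leafExcess [⟨V, inferInstance, T⟩] = (numLeaves T : ℤ) - 2 := by simp [leafExcess]
    by_cases h : ∃ c, 3 ≤ vertexDegree T c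
    · obtain ⟨c, hc⟩ := h
      have hdeg : ∀ v, v ≠ c → vertexDegree T v ≤ 2 := by
        intro v hv
        by_contra h3
        exact hv (high v c (by omega) hc)
      obtain ⟨u, hu⟩ : ∃ u, T.Adj c u := by
        rw [vertexDegree_eq_card] at hc
        obtain ⟨u, hu⟩ := Finset.card_pos.1 (show 0 < (Finset.univ.filter (T.Adj c)).card by omega)
        exact ⟨u, by simpa using hu⟩
      obtain ⟨Z, hZ, hf⟩ := exists_zeroForcing_of_starlike N hT hu hdeg (by omega)
      refine ⟨Z, ?_, hf⟩
      rw [hex, numLeaves_eq_vertexDegree hT hc hdeg]; omega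
    · have hdeg : ∀ v, vertexDegree T v ≤ 2 := by
        intro v
        by_contra h3
        exact h ⟨v, by omega⟩
      obtain ⟨Z, hZ, hf⟩ := exists_zeroForcing_of_path N hT hV hdeg
      refine ⟨Z, ?_, hf⟩
      rw [hex, numLeaves_eq_two hT hV hdeg]; omega
  | @split V A B _ _ _ T S T' x y L hs _ ih =>
    obtain ⟨Z', hZ', hforce'⟩ := ih hs.two_le_card
    obtain ⟨f, g, h1, h2, h3⟩ := hs.merge
    have hm : IsMerge T S x T' y f g := ⟨h1, h2, h3⟩
    obtain ⟨c, hcx, hxc, hxu, hdeg, hc3, hleaves⟩ := hs.exists_center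
    have hex : leafExcess (⟨A, inferInstance, S⟩ :: L) = (numLeaves S : ℤ) - 2 + leafExcess L := by
      simp [leafExcess]
    have hxN : x ∈ Finset.univ.filter (S.Adj c) := by simpa using hxc.symm
    have hcard1 : ((Finset.univ.filter (S.Adj c)).erase x).card + 1 = vertexDegree S c := by
      rw [vertexDegree_eq_card]; exact Finset.card_erase_add_one hxN
    obtain ⟨u, huN⟩ := Finset.card_pos.1
      (show 0 < ((Finset.univ.filter (S.Adj c)).erase x).card by omega)
    have hu : S.Adj c u ∧ u ≠ x := by simp at huN; exact ⟨huN.2, huN.1⟩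
    have hcard2 := Finset.card_erase_add_one huN
    -- Two arms are left out: the value at `x` will come from `T'`, and the value at `u` from the
    -- equation at `c`.
    set J := ((Finset.univ.filter (S.Adj c)).erase x).erase u with hJ
    have hJmem : ∀ w, w ∈ J ↔ S.Adj c w ∧ w ≠ x ∧ w ≠ u := fun w => by simp [hJ]; tauto
    have hP : ∀ a, a = x → ∀ b, S.Adj a b → b = c := by rintro a rfl b hb; exact hxu b hb
    obtain ⟨Z, hZ, hforce⟩ := exists_forcing_finset N hs.starlike.1.2 (c := c) (P := fun a => a = x)
      hP hdeg J (Finset.card_pos.1 (by omega)) (fun w hw => ((hJmem w).1 hw).1)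
      (fun w hw => ((hJmem w).1 hw).2.1)
    refine ⟨Z.map f ∪ Z'.map g, ?_, fun d h hh hz => ?_⟩
    · have := Finset.card_union_le (Z.map f) (Z'.map g)
      rw [Finset.card_map, Finset.card_map] at this
      rw [hex, hleaves]
      omega
    · have hS : ∀ a, a ≠ c → ¬ a = x → IsHarmonicAt S (d ∘ f) (h ∘ f) a := fun a _ hax =>
        (hh (f a)).comp_embedding f (fun a' ha' => hm.adj_left ha')
          (fun w hw => Or.inl (hm.adj_left_of_ne hax hw))
      obtain ⟨hc0, hJ0⟩ := hforce (d ∘ f) (h ∘ f) hS fun z hz' =>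
        hz _ (Finset.mem_union_left _ (Finset.mem_map_of_mem f hz'))
      -- The only neighbour that a vertex of `T'` gains in `T` is `c`, adjacent to the glued vertex,
      -- and `h` already vanishes there. So the restriction to `T'` is harmonic and induction
      -- applies.
      have hT' : ∀ b, IsHarmonicAt T' (d ∘ g) (h ∘ g) b := fun b =>
        (hh (g b)).comp_embedding g (fun b' hb' => hm.adj_right hb') fun w hw => by
          rcases hm.adj_right_or hw with h' | ⟨a', ha', rfl⟩
          · exact Or.inl h'
          · rw [hxu a' ha']; exact Or.inr hc0
      have hg0 := hforce' (d ∘ g) (h ∘ g) hT' fun z hz' =>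
        hz _ (Finset.mem_union_right _ (Finset.mem_map_of_mem g hz'))
      have hx0 : (h ∘ f) x = 0 := by
        have := hg0 y
        rwa [Function.comp_apply, ← hm.apply_eq] at this
      have hSc : IsHarmonicAt S (d ∘ f) (h ∘ f) c :=
        (hh (f c)).comp_embedding f (fun a' ha' => hm.adj_left ha')
          (fun w hw => Or.inl (hm.adj_left_of_ne hcx hw))
      have hnb : ∀ w, S.Adj c w → w ≠ u → (h ∘ f) w = 0 := by
        intro w hw hwu
        by_cases hwx : w = x
        · rw [hwx]; exact hx0
        · exact hJ0 w ((hJmem w).2 ⟨hw, hwx, hwu⟩)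
      have hu0 := hSc.eq_zero_of_forall_ne hc0 hu.1 hnb
      have hf0 := eq_zero_of_center_eq_zero hs.starlike.1.1 hP hdeg hS hc0 fun w hw => by
        by_cases hwu : w = u
        · rw [hwu]; exact hu0
        · exact hnb w hw hwu
      intro v
      rcases h2 v with ⟨a, rfl⟩ | ⟨b, rfl⟩
      · exact hf0 a
      · exact hg0 b

end ZeroForcing

/-! ### The cokernel as universal target of harmonic functions -/

section Cokernel

variable {V : Type u} [Fintype V] {N : Type*} [AddCommGroup N]

open scoped Classical in
theorem generalizedLaplacian_mulVec_apply (G : SimpleGraph V) (d x : V → ℤ) (v : V) :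
    (generalizedLaplacian G d).mulVec x v = d v * x v - ∑ w with G.Adj v w, x w := by
  rw [generalizedLaplacian, Matrix.sub_mulVec, Pi.sub_apply, Matrix.mulVec_diagonal,
    SimpleGraph.adjMatrix_mulVec_apply, SimpleGraph.neighborFinset_eq_filter]

theorem isHarmonicAt_iff_mulVec_eq_zero (G : SimpleGraph V) (d r : V → ℤ) :
    (∀ v, IsHarmonicAt G d r v) ↔ (generalizedLaplacian G d).mulVec r = 0 := by
  rw [funext_iff]
  refine forall_congr' fun v => ?_
  rw [generalizedLaplacian_mulVec_apply, Pi.zero_apply, sub_eq_zero]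
  rfl

open scoped Classical in
/-- The class of the vertex `v` in the cokernel of the Laplacian. -/
noncomputable def vertexClass (G : SimpleGraph V) (d : V → ℤ) (v : V) : LaplacianCokernel G d :=
  Submodule.Quotient.mk (Pi.single v 1)

/-- The Laplacian is symmetric, so its column at `v`, which dies in the cokernel, has the
coefficients of the equation at `v`. -/
theorem isHarmonicAt_vertexClass (G : SimpleGraph V) (d : V → ℤ) (v : V) :
    IsHarmonicAt G d (vertexClass G d) v := by
  classical
  have h : (generalizedLaplacian G d).mulVec (Pi.single v 1) =
      d v • Pi.single v 1 - ∑ w with G.Adj v w, Pi.single w 1 := by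
    ext u
    rw [generalizedLaplacian_mulVec_apply]
    simp only [Pi.sub_apply, Pi.smul_apply, Finset.sum_apply, Pi.single_apply, smul_eq_mul]
    simp only [Finset.sum_ite_eq, Finset.sum_ite_eq', Finset.mem_filter, Finset.mem_univ, true_and,
      G.adj_comm v u]
    congr 1
    split_ifs with huv
    · rw [huv]
    · simp
  have h0 : (Submodule.Quotient.mk ((generalizedLaplacian G d).mulVec (Pi.single v 1)) :
      LaplacianCokernel G d) = 0 := by
    rw [Submodule.Quotient.mk_eq_zero]
    exact ⟨Pi.single v 1, rfl⟩
  have hS : ∀ s : Finset V, (Submodule.Quotient.mk (∑ w ∈ s, Pi.single w 1) :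
      LaplacianCokernel G d) = ∑ w ∈ s, vertexClass G d w := by
    intro s
    rw [← Submodule.mkQ_apply, map_sum]
    refine Finset.sum_congr rfl fun w _ => ?_
    rw [Submodule.mkQ_apply]
    unfold vertexClass; congr!
  rw [h, Submodule.Quotient.mk_sub, Submodule.Quotient.mk_smul, sub_eq_zero, hS] at h0
  unfold IsHarmonicAt
  rw [← h0]
  unfold vertexClass; congr!

theorem cokernel_induction {G : SimpleGraph V} {d : V → ℤ} (φ ψ : LaplacianCokernel G d →+ N)
    (h : ∀ v, φ (vertexClass G d v) = ψ (vertexClass G d v)) : φ = ψ := by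
  classical
  have : φ.toIntLinearMap = ψ.toIntLinearMap := by
    refine Submodule.linearMap_qext _ (LinearMap.pi_ext' fun v => LinearMap.ext_ring ?_)
    have := h v
    unfold vertexClass at this
    simp only [LinearMap.comp_apply, Submodule.mkQ_apply, LinearMap.single_apply,
      AddMonoidHom.coe_toIntLinearMap]
    convert this
  exact AddMonoidHom.ext fun x => LinearMap.congr_fun this x

theorem exists_cokernel_lift {G : SimpleGraph V} {d : V → ℤ} {g : V → N}
    (hg : ∀ v, IsHarmonicAt G d g v) :
    ∃ φ : LaplacianCokernel G d →+ N, ∀ v, φ (vertexClass G d v) = g v := by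
  classical
  have hcol : ∀ x : V → ℤ,
      Fintype.linearCombination ℤ g ((generalizedLaplacian G d).mulVec x) = 0 := by
    intro x
    simp only [Fintype.linearCombination_apply, generalizedLaplacian_mulVec_apply, sub_smul,
      Finset.sum_sub_distrib, Finset.sum_smul, mul_comm (d _), mul_smul]
    rw [sub_eq_zero]
    simp only [Finset.sum_filter]
    rw [Finset.sum_comm]
    refine Finset.sum_congr rfl fun v _ => ?_
    rw [hg v, Finset.smul_sum, Finset.sum_filter]
    refine Finset.sum_congr rfl fun w _ => ?_
    simp only [G.adj_comm v w]
  refine ⟨((LinearMap.range (generalizedLaplacian G d).mulVecLin).liftQ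
    (Fintype.linearCombination ℤ g) ?_).toAddMonoidHom, fun v => ?_⟩
  · rintro _ ⟨x, rfl⟩
    exact hcol x
  · simp [vertexClass]

/-- A functional on `(ℤ/p)^s × ℤ/p` pulls back to a harmonic function, which is determined by its
values on `Z`; comparing dimensions gives `s + 1 ≤ |Z|`. -/
theorem hasNumInvariantFactors_le_of_zeroForcing {G : SimpleGraph V} {d r : V → ℤ} {m : ℤ}
    [Nonempty V] (hdr : IsArithmeticalStructure G d r) {s : ℕ}
    (hs : HasNumInvariantFactors (CriticalGroup G d) s)
    (hZ : ∀ p : ℕ, ∃ Z : Finset V, (Z.card : ℤ) ≤ 1 + m ∧ ∀ (d : V → ℤ) (g : V → ZMod p),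
      (∀ v, IsHarmonicAt G d g v) → (∀ z ∈ Z, g z = 0) → ∀ v, g v = 0) : (s : ℤ) ≤ m := by
  classical
  obtain ⟨α, hα, hdvd, ⟨E⟩⟩ := hs
  -- A prime factor of the first invariant factor divides all of them; with no factors, any prime
  -- serves.
  obtain ⟨p, hp, hpα⟩ : ∃ p : ℕ, p.Prime ∧ ∀ i, p ∣ α i := by
    cases s with
    | zero => exact ⟨2, Nat.prime_two, fun i => i.elim0⟩
    | succ s =>
      obtain ⟨p, hp, hpd⟩ := Nat.exists_prime_and_dvd (hα 0).ne'
      exact ⟨p, hp, fun i => hpd.trans (hdvd 0 i (Fin.zero_le _))⟩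
  have := Fact.mk hp
  obtain ⟨ρ, hρ⟩ := exists_cokernel_lift ((isHarmonicAt_iff_mulVec_eq_zero G d r).2
    hdr.laplacian_mulVec)
  have hρ0 : ρ ≠ 0 := by
    rintro rfl
    obtain ⟨v⟩ := ‹Nonempty V›
    exact (hdr.r_pos v).ne (hρ v)
  obtain ⟨φ, hφ⟩ := exists_surjective_torsion_reduction p ρ hρ0 α hpα E
  obtain ⟨Z, hZc, hZ⟩ := hZ p
  let Φ : ((Fin s → ZMod p) × ZMod p →ₗ[ZMod p] ZMod p) →ₗ[ZMod p] (Z → ZMod p) :=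
    { toFun := fun l z => l (φ (vertexClass G d z))
      map_add' := fun _ _ => rfl
      map_smul' := fun _ _ => rfl }
  have hinj : Function.Injective Φ := by
    rw [injective_iff_map_eq_zero]
    intro l hl
    have h0 : ∀ v, l (φ (vertexClass G d v)) = 0 := by
      refine hZ d _ (fun v => ?_) fun z hz => congrFun hl ⟨z, hz⟩
      have h := congrArg (fun x => l (φ x)) (isHarmonicAt_vertexClass G d v)
      simp only [map_zsmul, map_sum] at h
      exact h
    have h1 : l.toAddMonoidHom.comp φ = 0 := cokernel_induction _ _ h0
    refine LinearMap.ext fun y => ?_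
    obtain ⟨x, rfl⟩ := hφ y
    exact DFunLike.congr_fun h1 x
  have h := LinearMap.finrank_le_finrank_of_injective hinj
  rw [Module.finrank_linearMap] at h
  simp at h
  omega

end Cokernel

/-! ### Realizing a prescribed cokernel on an induced subgraph -/

section Realization

variable {V : Type u} {N : Type*} [AddCommGroup N]

open scoped Classical in
/-- `g` satisfies the harmonicity equations of the subgraph induced on `U`. -/
def IsHarmonicOn (G : SimpleGraph V) (U : Finset V) (d : V → ℤ) (g : V → N) : Prop :=
  ∀ v ∈ U, d v • g v = ∑ w ∈ U, if G.Adj v w then g w else 0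

theorem IsHarmonicOn.congr {G : SimpleGraph V} {U : Finset V} {d d' : V → ℤ} {g g' : V → N}
    (h : IsHarmonicOn G U d g) (hd : ∀ v ∈ U, d v = d' v) (hg : ∀ v ∈ U, g v = g' v) :
    IsHarmonicOn G U d' g' := by
  classical
  intro v hv
  rw [← hd v hv, ← hg v hv, h v hv]
  refine Finset.sum_congr rfl fun w hw => ?_
  rw [hg w hw]

theorem IsHarmonicOn.map {M : Type*} [AddCommGroup M] {G : SimpleGraph V} {U : Finset V}
    {d : V → ℤ} {g : V → N} (h : IsHarmonicOn G U d g) (φ : N →+ M) :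
    IsHarmonicOn G U d fun v => φ (g v) := by
  classical
  intro v hv
  have h := congrArg φ (h v hv)
  rw [map_zsmul, map_sum] at h
  simp only [apply_ite φ, map_zero] at h
  exact h

theorem isHarmonicOn_univ [Fintype V] {G : SimpleGraph V} {d : V → ℤ} {g : V → N} :
    IsHarmonicOn G Finset.univ d g ↔ ∀ v, IsHarmonicAt G d g v := by
  simp [IsHarmonicOn, IsHarmonicAt, Finset.sum_filter]

/-- The subgraph of `G` induced on `U` has an arithmetical structure for which the cokernel of the
Laplacian is isomorphic to `M`; the cokernel is described by its universal property with respect to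
harmonic functions. -/
def IsRealizedOn (G : SimpleGraph V) (U : Finset V) (M : Type*) [AddCommGroup M] : Prop :=
  ∃ (d r : V → ℤ) (f : V → M), (∀ v ∈ U, 0 ≤ d v) ∧ (∀ v ∈ U, 0 < r v) ∧
    (∀ k : ℤ, (∀ v ∈ U, k ∣ r v) → IsUnit k) ∧ IsHarmonicOn G U d r ∧ IsHarmonicOn G U d f ∧
    (∀ H : AddSubgroup M, (∀ v ∈ U, f v ∈ H) → H = ⊤) ∧
    ∀ (N : Type u) [AddCommGroup N] (g : V → N), IsHarmonicOn G U d g →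
      ∃ h : M →+ N, ∀ v ∈ U, h (f v) = g v

theorem IsRealizedOn.of_addEquiv {G : SimpleGraph V} {U : Finset V} {M M' : Type*} [AddCommGroup M]
    [AddCommGroup M'] (h : IsRealizedOn G U M) (E : M ≃+ M') : IsRealizedOn G U M' := by
  classical
  obtain ⟨d, r, f, h1, h2, h3, h4, h5, h6, h7⟩ := h
  refine ⟨d, r, E ∘ f, h1, h2, h3, h4, h5.map E.toAddMonoidHom, fun H hH => ?_, fun N _ g hg => ?_⟩
  · have := h6 (H.comap E.toAddMonoidHom) hH
    rw [eq_top_iff]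
    intro x _
    have h8 : E.symm x ∈ H.comap E.toAddMonoidHom := by rw [this]; trivial
    simpa using h8
  · obtain ⟨h, hh⟩ := h7 N g hg
    exact ⟨h.comp E.symm.toAddMonoidHom, fun v hv => by simpa using hh v hv⟩

theorem isRealizedOn_singleton (G : SimpleGraph V) (v : V) : IsRealizedOn G {v} ℤ := by
  classical
  refine ⟨0, 1, 1, by simp, by simp, fun k hk => isUnit_of_dvd_one (hk v (by simp)), ?_, ?_,
    fun H hH => ?_, fun N _ g _ => ⟨zmultiplesHom N (g v), by simp⟩⟩
  · intro w hw; obtain rfl := Finset.mem_singleton.1 hw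
    rw [Finset.sum_singleton, if_neg G.irrefl, Pi.zero_apply, zero_smul]
  · intro w hw; obtain rfl := Finset.mem_singleton.1 hw
    rw [Finset.sum_singleton, if_neg G.irrefl, Pi.zero_apply, zero_smul]
  · rw [eq_top_iff]
    intro n _
    have := H.zsmul_mem (hH v (by simp)) n
    simpa using this

open scoped Classical in
-- With diagonal entry `1` at the leaf, its equation reads `g w = g u`, and the extra `g u` on the
-- left at `u` cancels the new term `g w` on the right.
theorem isHarmonicOn_insert_iff {G : SimpleGraph V} {U : Finset V} {w u : V} (hw : w ∉ U)
    (hu : u ∈ U) (hadj : ∀ v ∈ U, G.Adj w v ↔ v = u) (d : V → ℤ) (g : V → N) :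
    IsHarmonicOn G (insert w U) (fun v => if v = w then 1 else if v = u then d u + 1 else d v) g ↔
      g w = g u ∧ IsHarmonicOn G U d g := by
  have hne : ∀ v ∈ U, v ≠ w := fun v hv h => hw (h ▸ hv)
  have hsumw : (∑ x ∈ insert w U, if G.Adj w x then g x else 0) = g u := by
    rw [Finset.sum_insert hw, if_neg (G.irrefl), zero_add,
      Finset.sum_congr rfl fun x hx => by rw [if_congr (hadj x hx) rfl rfl]]
    simp [hu]
  have hsum : ∀ v ∈ U, (∑ x ∈ insert w U, if G.Adj v x then g x else 0) =
      (if v = u then g w else 0) + ∑ x ∈ U, if G.Adj v x then g x else 0 := by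
    intro v hv
    rw [Finset.sum_insert hw, if_congr ((G.adj_comm v w).trans (hadj v hv)) rfl rfl]
  unfold IsHarmonicOn
  rw [Finset.forall_mem_insert, hsumw]
  simp only [if_true, one_smul]
  refine and_congr_right fun hwu => forall₂_congr fun v hv => ?_
  rw [hsum v hv]
  simp only [if_neg (hne v hv)]
  by_cases hvu : v = u
  · subst hvu
    rw [if_pos rfl, if_pos rfl, add_smul, one_smul, hwu, add_comm, add_right_inj]
  · rw [if_neg hvu, if_neg hvu, zero_add]

open scoped Classical in
/-- Attaching a leaf does not change the cokernel. -/
theorem IsRealizedOn.insert_leaf {G : SimpleGraph V} {U : Finset V} {M : Type*} [AddCommGroup M]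
    (h : IsRealizedOn G U M) {w u : V} (hw : w ∉ U)
    (hu : u ∈ U) (hadj : ∀ v ∈ U, G.Adj w v ↔ v = u) :
    IsRealizedOn G (insert w U) M := by
  classical
  obtain ⟨d, r, f, h1, h2, h3, h4, h5, h6, h7⟩ := h
  have hne : ∀ v ∈ U, v ≠ w := fun v hv h => hw (h ▸ hv)
  have hext : ∀ {N : Type _} (g : V → N), ∀ v ∈ U, g v = if v = w then g u else g v :=
    fun g v hv => by rw [if_neg (hne v hv)]
  have hext' : ∀ (g : V → ℤ), ∀ v ∈ U, g v = if v = w then g u else g v :=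
    fun g v hv => by rw [if_neg (hne v hv)]
  refine ⟨_, fun v => if v = w then r u else r v, fun v => if v = w then f u else f v, ?_, ?_,
    fun k hk => h3 k fun v hv => ?_,
    (isHarmonicOn_insert_iff hw hu hadj d _).2 ⟨?_, h4.congr (fun _ _ => rfl) (hext' r)⟩,
    (isHarmonicOn_insert_iff hw hu hadj d _).2 ⟨?_, h5.congr (fun _ _ => rfl) (hext f)⟩,
    fun H hH => h6 H fun v hv => ?_, fun N _ g hg => ?_⟩
  · intro v hv
    rcases Finset.mem_insert.1 hv with rfl | hv
    · simp
    · have := h1 v hv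
      have := h1 u hu
      simp only [if_neg (hne v hv)]
      split_ifs <;> omega
  · intro v hv
    rcases Finset.mem_insert.1 hv with rfl | hv
    · simpa using h2 u hu
    · simpa [if_neg (hne v hv)] using h2 v hv
  · simpa [if_neg (hne v hv)] using hk v (Finset.mem_insert_of_mem hv)
  · simp [hne u hu]
  · simp [hne u hu]
  · simpa [if_neg (hne v hv)] using hH v (Finset.mem_insert_of_mem hv)
  · obtain ⟨hgw, hgU⟩ := (isHarmonicOn_insert_iff hw hu hadj d g).1 hg
    obtain ⟨h, hh⟩ := h7 N g hgU
    refine ⟨h, fun v hv => ?_⟩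
    rcases Finset.mem_insert.1 hv with rfl | hv
    · simp [hgw, hh u hu]
    · simp [if_neg (hne v hv), hh v hv]

/-- A star with centre `c` and leaves `i₀` and `J` that is attached to `U` by the edge `v₀ c`. -/
structure IsPendantStar (G : SimpleGraph V) (U : Finset V) (v₀ c i₀ : V) (J : Finset V) : Prop where
  mem : v₀ ∈ U
  center_notMem : c ∉ U
  ne_center : i₀ ≠ c
  center_notMem_leaves : c ∉ J
  notMem : i₀ ∉ U
  notMem_leaves : i₀ ∉ J
  disjoint : ∀ i ∈ J, i ∉ U
  adj_iff : ∀ v ∈ U, G.Adj c v ↔ v = v₀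
  adj : G.Adj c i₀
  adj_leaves : ∀ i ∈ J, G.Adj c i
  not_adj : ∀ v ∈ U, ¬ G.Adj v i₀
  not_adj_leaves : ∀ v ∈ U, ∀ i ∈ J, ¬ G.Adj v i
  not_adj_leaf : ∀ i ∈ J, ¬ G.Adj i₀ i
  not_adj_of_leaves : ∀ i ∈ J, ∀ j ∈ J, ¬ G.Adj i j

open scoped Classical in
/-- Piecewise definition of a function on `U ∪ {c, i₀} ∪ J`. -/
noncomputable def starExtend {X : Type*} (U : Finset V) (c i₀ : V) (g : V → X)
    (xc xi : X) (xJ : V → X) (v : V) : X :=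
  if v ∈ U then g v else if v = c then xc else if v = i₀ then xi else xJ v

theorem starExtend_of_mem {X : Type*} {U : Finset V} {c i₀ : V} (g : V → X)
    (xc xi : X) (xJ : V → X) {v : V} (hv : v ∈ U) : starExtend U c i₀ g xc xi xJ v = g v :=
  if_pos hv

open scoped Classical in
theorem forall_mem_union_star_iff {U J : Finset V} {c i₀ : V} {p : V → Prop} :
    (∀ v ∈ U ∪ insert c (insert i₀ J), p v) ↔ (∀ v ∈ U, p v) ∧ p c ∧ p i₀ ∧ ∀ i ∈ J, p i := by
  rw [Finset.forall_mem_union, Finset.forall_mem_insert, Finset.forall_mem_insert]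

namespace IsPendantStar

variable {G : SimpleGraph V} {U : Finset V} {v₀ c i₀ : V} {J : Finset V}

section
variable {X : Type*} (g : V → X) (xc xi : X) (xJ : V → X)

theorem starExtend_center (hs : IsPendantStar G U v₀ c i₀ J) : starExtend U c i₀ g xc xi xJ c = xc := by
  simp [starExtend, hs.center_notMem]

theorem starExtend_leaf (hs : IsPendantStar G U v₀ c i₀ J) : starExtend U c i₀ g xc xi xJ i₀ = xi := by
  simp [starExtend, hs.notMem, hs.ne_center]

theorem starExtend_leaves (hs : IsPendantStar G U v₀ c i₀ J)
    {i : V} (hi : i ∈ J) : starExtend U c i₀ g xc xi xJ i = xJ i := by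
  have h1 : i ≠ c := fun h => hs.center_notMem_leaves (h ▸ hi)
  have h2 : i ≠ i₀ := fun h => hs.notMem_leaves (h ▸ hi)
  simp [starExtend, hs.disjoint i hi, h1, h2]

end

open scoped Classical in
theorem isHarmonicOn_iff (hs : IsPendantStar G U v₀ c i₀ J) (d : V → ℤ) (k e : ℤ)
    (hke : 2 * k * e = 2 + k * J.card) (g : V → N) :
    IsHarmonicOn G (U ∪ insert c (insert i₀ J))
        (starExtend U c i₀ (fun v => if v = v₀ then d v₀ + 2 * k else d v) e (2 * k) fun _ => 2) g ↔
      IsHarmonicOn G U d g ∧ e • g c = g v₀ + g i₀ + ∑ i ∈ J, g i ∧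
        (2 * k) • g i₀ = g c ∧ ∀ i ∈ J, (2 : ℤ) • g i = g c := by
  have hsum : ∀ F : V → N, ∑ x ∈ U ∪ insert c (insert i₀ J), F x =
      ∑ x ∈ U, F x + (F c + (F i₀ + ∑ x ∈ J, F x)) := by
    intro F
    rw [Finset.sum_union, Finset.sum_insert, Finset.sum_insert hs.notMem_leaves]
    · simp [hs.ne_center.symm, hs.center_notMem_leaves]
    · simp only [Finset.disjoint_insert_right]
      exact ⟨hs.center_notMem, hs.notMem, Finset.disjoint_right.2 hs.disjoint⟩
  have hc : (∑ x ∈ U ∪ insert c (insert i₀ J), if G.Adj c x then g x else 0) =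
      g v₀ + g i₀ + ∑ i ∈ J, g i := by
    rw [hsum, if_neg G.irrefl, if_pos hs.adj, zero_add, add_assoc,
      Finset.sum_congr (g := fun x => if x = v₀ then g x else 0) rfl
        fun x hx => if_congr (hs.adj_iff x hx) rfl rfl,
      Finset.sum_congr (s₁ := J) (g := g) rfl fun x hx => if_pos (hs.adj_leaves x hx)]
    simp [hs.mem]
  have hi : (∑ x ∈ U ∪ insert c (insert i₀ J), if G.Adj i₀ x then g x else 0) = g c := by
    rw [hsum, if_pos hs.adj.symm, if_neg G.irrefl,
      Finset.sum_eq_zero fun x hx => if_neg fun h => hs.not_adj x hx h.symm,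
      Finset.sum_eq_zero fun x hx => if_neg (hs.not_adj_leaf x hx)]
    simp
  have hj : ∀ i ∈ J, (∑ x ∈ U ∪ insert c (insert i₀ J), if G.Adj i x then g x else 0) = g c := by
    intro i hiJ
    rw [hsum, if_pos (hs.adj_leaves i hiJ).symm, if_neg fun h => hs.not_adj_leaf i hiJ h.symm,
      Finset.sum_eq_zero fun x hx => if_neg fun h => hs.not_adj_leaves x hx i hiJ h.symm,
      Finset.sum_eq_zero fun x hx => if_neg (hs.not_adj_of_leaves i hiJ x hx)]
    simp
  have hU : ∀ v ∈ U, (∑ x ∈ U ∪ insert c (insert i₀ J), if G.Adj v x then g x else 0) =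
      (∑ x ∈ U, if G.Adj v x then g x else 0) + if v = v₀ then g c else 0 := by
    intro v hv
    rw [hsum, if_neg (hs.not_adj v hv), if_congr ((G.adj_comm v c).trans (hs.adj_iff v hv)) rfl rfl,
      Finset.sum_eq_zero fun x hx => if_neg (hs.not_adj_leaves v hv x hx)]
    simp
  unfold IsHarmonicOn
  rw [forall_mem_union_star_iff, hc, hi, hs.starExtend_center, hs.starExtend_leaf]
  have hJ : (∀ i ∈ J, (starExtend U c i₀ (fun v => if v = v₀ then d v₀ + 2 * k else d v) e (2 * k)
      fun _ => 2) i • g i = ∑ x ∈ U ∪ insert c (insert i₀ J), if G.Adj i x then g x else 0) ↔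
      ∀ i ∈ J, (2 : ℤ) • g i = g c :=
    forall₂_congr fun i hiJ => by rw [hj i hiJ, hs.starExtend_leaves _ _ _ _ hiJ]
  rw [hJ]
  refine and_congr_left fun ⟨h1, h2, h3⟩ => forall₂_congr fun v hv => ?_
  rw [hU v hv, starExtend_of_mem _ _ _ _ hv]
  by_cases hvv : v = v₀
  · subst hvv
    -- Multiply the equation at `c` by `2 * k`. The leaf equations and `hke` turn it into `(2 +
    -- k|J|) g c = 2k g v₀ + g c + k|J| g c`. Hence raising the diagonal entry at `v₀` by `2 * k`
    -- exactly absorbs the new neighbour `c`.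
    have h4 : (2 * k) • g v = g c := by
      have h5 := congrArg (fun x => (2 * k) • x) h1
      simp only [smul_add, h2, smul_smul, hke, Finset.smul_sum] at h5
      rw [Finset.sum_congr rfl fun i hiJ => by rw [mul_comm 2 k, mul_smul, h3 i hiJ],
        Finset.sum_const, ← natCast_zsmul, smul_smul, mul_comm (J.card : ℤ) k, add_smul, two_smul,
        add_left_inj, add_left_inj] at h5
      exact h5.symm
    rw [if_pos rfl, if_pos rfl, add_smul, h4, add_left_inj]
  · rw [if_neg hvv, if_neg hvv, add_zero]

end IsPendantStar

end Realization

/-! ### A pendant star adds a power of `ℤ/2` -/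

section Step

variable {V : Type u}

open scoped Classical in
-- The elements `g j - k g i₀`, for `j ∈ J`, are killed by `2`, since both `2 g j` and `2k g i₀`
-- equal `g c`. The equation at `c` then becomes `g i₀ = g v₀ + ∑ (g j - k g i₀)`, so the star adds
-- these elements as generators of order two and no other relation.
theorem IsPendantStar.isRealizedOn {G : SimpleGraph V} {U : Finset V} {v₀ c i₀ : V} {J : Finset V}
    (hs : IsPendantStar G U v₀ c i₀ J) {M : Type*} [AddCommGroup M] (h : IsRealizedOn G U M)
    (k e : ℤ) (hk : 0 < k) (he : 0 ≤ e) (hke : 2 * k * e = 2 + k * J.card) :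
    IsRealizedOn G (U ∪ insert c (insert i₀ J)) (M × (J → ZMod 2)) := by
  obtain ⟨d, r, f, h1, h2, h3, h4, h5, h6, h7⟩ := h
  set r' : V → ℤ := starExtend U c i₀ r (2 * k * r v₀) (r v₀) fun _ => k * r v₀ with hr'
  -- The values are read off by letting `g j - k g i₀` be the basis vector at `j`; the all-ones
  -- vector at `i₀` is the sum of these basis vectors.
  set f' : V → M × (J → ZMod 2) := starExtend U c i₀ (fun v => (f v, 0)) ((2 * k) • f v₀, 0)
    (f v₀, 1) fun i => (k • f v₀, fun j => k + if (j : V) = i then 1 else 0) with hf'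
  have hrU : ∀ v ∈ U, r' v = r v := fun v hv => starExtend_of_mem _ _ _ _ hv
  have hfU : ∀ v ∈ U, f' v = (f v, 0) := fun v hv => starExtend_of_mem _ _ _ _ hv
  have hrc : r' c = 2 * k * r v₀ := hs.starExtend_center _ _ _ _
  have hri : r' i₀ = r v₀ := hs.starExtend_leaf _ _ _ _
  have hrJ : ∀ i ∈ J, r' i = k * r v₀ := fun i hi => hs.starExtend_leaves _ _ _ _ hi
  have hfc : f' c = ((2 * k) • f v₀, 0) := hs.starExtend_center _ _ _ _
  have hfi : f' i₀ = (f v₀, 1) := hs.starExtend_leaf _ _ _ _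
  have hfJ : ∀ i ∈ J, f' i = (k • f v₀, fun j : J => (k : ZMod 2) + if (j : V) = i then 1 else 0) :=
    fun i hi => hs.starExtend_leaves _ _ _ _ hi
  have hr0 : 0 < r v₀ := h2 v₀ hs.mem
  have htwo : ((2 : ℤ) : ZMod 2) = 0 := rfl
  refine ⟨_, r', f', forall_mem_union_star_iff.2 ⟨?_, ?_, ?_, ?_⟩,
    forall_mem_union_star_iff.2 ⟨?_, ?_, ?_, ?_⟩, fun m hm => h3 m fun v hv => ?_,
    (hs.isHarmonicOn_iff d k e hke r').2 ⟨h4.congr (fun _ _ => rfl) fun v hv => (hrU v hv).symm,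
      ?_, ?_, ?_⟩,
    (hs.isHarmonicOn_iff d k e hke f').2
      ⟨(h5.map (AddMonoidHom.inl M (J → ZMod 2))).congr (fun _ _ => rfl)
        fun v hv => (hfU v hv).symm, ?_, ?_, ?_⟩, fun H hH => ?_, fun N _ g hg => ?_⟩
  · intro v hv
    rw [starExtend_of_mem _ _ _ _ hv]
    have := h1 v hv
    have := h1 v₀ hs.mem
    split_ifs <;> omega
  · rwa [hs.starExtend_center]
  · rw [hs.starExtend_leaf]; omega
  · intro i hi
    rw [hs.starExtend_leaves _ _ _ _ hi]; norm_num
  · intro v hv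
    rw [hrU v hv]; exact h2 v hv
  · rw [hrc]; positivity
  · rwa [hri]
  · intro i hi
    rw [hrJ i hi]; positivity
  · rw [← hrU v hv]
    exact hm v (Finset.mem_union_left _ hv)
  · rw [hrc, hrU _ hs.mem, hri, Finset.sum_congr rfl hrJ, Finset.sum_const, nsmul_eq_mul,
      smul_eq_mul]
    linear_combination (r v₀) * hke
  · rw [hri, hrc, smul_eq_mul]
  · intro i hi
    rw [hrJ i hi, hrc, smul_eq_mul, mul_assoc]
  · rw [hfc, hfU _ hs.mem, hfi, Finset.sum_congr rfl hfJ]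
    refine Prod.ext ?_ (funext fun j => ?_)
    · simp only [Prod.smul_fst, Prod.fst_add, Prod.fst_sum, Finset.sum_const]
      rw [smul_smul, mul_comm e, hke, add_smul, two_smul, ← natCast_zsmul, smul_smul, mul_comm k]
    · have hz : (2 : ZMod 2) * k * e = 2 + k * J.card := by exact_mod_cast congrArg (Int.cast (R := ZMod 2)) hke
      have h20 : (2 : ZMod 2) = 0 := rfl
      rw [h20, zero_mul, zero_mul, zero_add] at hz
      simp only [Prod.smul_snd, Prod.snd_add, Prod.snd_sum, Finset.sum_apply, Pi.add_apply,
        Pi.zero_apply, Pi.one_apply, smul_zero, Finset.sum_add_distrib, Finset.sum_const,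
        Finset.sum_ite_eq, j.2, if_true, nsmul_eq_mul]
      rw [mul_comm, ← hz]
      rfl
  · rw [hfi, hfc]
    refine Prod.ext rfl (funext fun j => ?_)
    simp only [Prod.smul_snd, Pi.smul_apply, Pi.one_apply, Pi.zero_apply, zsmul_eq_mul, mul_one]
    rw [Int.cast_mul, htwo, zero_mul]
  · intro i hi
    rw [hfJ i hi, hfc]
    refine Prod.ext (by simp [mul_smul]) (funext fun j => ?_)
    simp only [Prod.smul_snd, Pi.smul_apply, Pi.zero_apply, zsmul_eq_mul]
    rw [htwo, zero_mul]
  · obtain ⟨hHU, -, hHi, hHJ⟩ := forall_mem_union_star_iff.1 hH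
    have hM : ∀ m : M, (m, (0 : J → ZMod 2)) ∈ H := by
      intro m
      have : H.comap (AddMonoidHom.inl M (J → ZMod 2)) = ⊤ :=
        h6 _ fun v hv => by simpa [hfU v hv] using hHU v hv
      have hm : m ∈ H.comap (AddMonoidHom.inl M (J → ZMod 2)) := this ▸ AddSubgroup.mem_top m
      simpa using hm
    have hε : ∀ j : J, ((0 : M), (Pi.single j 1 : J → ZMod 2)) ∈ H := by
      intro j
      have := H.sub_mem (hHJ j j.2) (H.zsmul_mem hHi k)
      rw [hfJ j j.2, hfi] at this
      convert this using 1
      refine Prod.ext (by simp) (funext fun i => ?_)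
      simp [Pi.single_apply]
    rw [eq_top_iff]
    rintro ⟨m, b⟩ -
    have hb : (m, b) = (m, 0) + ∑ j : J, (b j).val • ((0 : M), (Pi.single j 1 : J → ZMod 2)) := by
      refine Prod.ext (by simp [Prod.fst_sum]) (funext fun i => ?_)
      simp only [Prod.snd_add, Prod.snd_sum, Prod.smul_snd, zero_add, Finset.sum_apply, Pi.smul_apply]
      simp only [Pi.single_apply, nsmul_eq_mul, mul_ite, mul_one, mul_zero,
        Finset.sum_ite_eq, Finset.mem_univ, if_true, ZMod.natCast_zmod_val]
    rw [hb]
    exact H.add_mem (hM m) (H.sum_mem fun j _ => H.nsmul_mem (hε j) _)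
  · obtain ⟨hgU, hgc, hgi, hgJ⟩ := (hs.isHarmonicOn_iff d k e hke g).1 hg
    obtain ⟨h, hh⟩ := h7 N g hgU
    have htors : ∀ j : J, zmultiplesHom N (g j - k • g i₀) (2 : ℕ) = 0 := by
      intro j
      rw [zmultiplesHom_apply]
      push_cast
      rw [smul_sub, hgJ j j.2, smul_smul, hgi, sub_self]
    let φ : J → ZMod 2 →+ N := fun j => ZMod.lift 2 ⟨zmultiplesHom N (g j - k • g i₀), htors j⟩
    have hφ : ∀ j (n : ℤ), φ j n = n • (g j - k • g i₀) := by
      intro j n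
      simp [φ, ZMod.lift_coe]
    have hφ1 : ∀ j, φ j 1 = g j - k • g i₀ := by
      intro j
      simpa using hφ j 1
    let Φ : M × (J → ZMod 2) →+ N := h.coprod (∑ j, (φ j).comp (Pi.evalAddMonoidHom _ j))
    have hΦ : ∀ m b, Φ (m, b) = h m + ∑ j, φ j (b j) := by
      intro m b
      simp [Φ, AddMonoidHom.finsetSum_apply]
    have hΦi : Φ (f' i₀) = g i₀ := by
      have h8 : (2 * k * e) • g i₀ = g v₀ + g i₀ + ∑ i ∈ J, g i := by
        rw [← hgc, ← hgi, smul_smul, mul_comm e]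
      rw [hke, add_smul, two_smul] at h8
      rw [hfi, hΦ, hh _ hs.mem]
      simp only [Pi.one_apply, hφ1]
      rw [Finset.sum_sub_distrib, Finset.sum_coe_sort J g, Finset.sum_const, Finset.card_univ,
        Fintype.card_coe, ← natCast_zsmul, smul_smul, mul_comm (J.card : ℤ) k]
      have h9 : g v₀ + ∑ i ∈ J, g i = g i₀ + (k * J.card) • g i₀ := by
        apply add_left_cancel (a := g i₀)
        rw [← add_assoc, ← add_assoc, h8]
        abel
      rw [← add_sub_assoc, h9, add_sub_cancel_right]
    refine ⟨Φ, forall_mem_union_star_iff.2 ⟨?_, ?_, hΦi, ?_⟩⟩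
    · intro v hv
      rw [hfU v hv, hΦ, hh v hv]
      simp
    · have : f' c = (2 * k) • f' i₀ := by
        rw [hfi, hfc]
        refine Prod.ext rfl (funext fun j => ?_)
        simp only [Prod.smul_snd, Pi.smul_apply, Pi.one_apply, Pi.zero_apply, zsmul_eq_mul, mul_one]
        rw [Int.cast_mul, htwo, zero_mul]
      rw [this, map_zsmul, hΦi, hgi]
    · intro i hi
      have : f' i = k • f' i₀ + (0, Pi.single ⟨i, hi⟩ 1) := by
        rw [hfi, hfJ i hi]
        refine Prod.ext (by simp) (funext fun j => ?_)
        simp [Pi.single_apply, Subtype.ext_iff]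
      rw [this, map_add, map_zsmul, hΦi, hΦ, map_zero, zero_add,
        Finset.sum_eq_single (⟨i, hi⟩ : J)]
      · rw [Pi.single_eq_same, hφ1, add_sub_cancel]
      · intro j _ hj
        rw [Pi.single_eq_of_ne hj, map_zero]
      · exact fun h => absurd (Finset.mem_univ _) h

end Step

/-! ### Growing connected vertex sets inside a tree -/

section Growth

variable {V : Type u}

/-- The subgraph of `G` induced on `U` is preconnected. -/
def IsPreconnectedOn (G : SimpleGraph V) (U : Finset V) : Prop :=
  ∀ a ∈ U, ∀ b ∈ U, ∃ p : G.Walk a b, ∀ x ∈ p.support, x ∈ U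

theorem isPreconnectedOn_singleton (G : SimpleGraph V) (v : V) : IsPreconnectedOn G {v} := by
  intro a ha b hb
  obtain rfl := Finset.mem_singleton.1 ha
  obtain rfl := Finset.mem_singleton.1 hb
  exact ⟨SimpleGraph.Walk.nil, by simp⟩

open scoped Classical in
theorem IsPreconnectedOn.insert_vertex {G : SimpleGraph V} {U : Finset V} (hU : IsPreconnectedOn G U)
    {w u : V} (hu : u ∈ U) (hwu : G.Adj w u) : IsPreconnectedOn G (insert w U) := by
  have key : ∀ a ∈ insert w U, ∃ p : G.Walk a u, ∀ x ∈ p.support, x ∈ insert w U := by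
    intro a ha
    rcases Finset.mem_insert.1 ha with rfl | ha
    · refine ⟨hwu.toWalk, fun x hx => ?_⟩
      simp only [SimpleGraph.Adj.toWalk, SimpleGraph.Walk.support_cons,
        SimpleGraph.Walk.support_nil, List.mem_cons, List.not_mem_nil, or_false] at hx
      rcases hx with rfl | rfl
      · exact Finset.mem_insert_self _ _
      · exact Finset.mem_insert_of_mem hu
    · obtain ⟨p, hp⟩ := hU a ha u hu
      exact ⟨p, fun x hx => Finset.mem_insert_of_mem (hp x hx)⟩
  intro a ha b hb
  obtain ⟨p, hp⟩ := key a ha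
  obtain ⟨q, hq⟩ := key b hb
  refine ⟨p.append q.reverse, fun x hx => ?_⟩
  rw [SimpleGraph.Walk.mem_support_append_iff, SimpleGraph.Walk.support_reverse,
    List.mem_reverse] at hx
  exact hx.elim (hp x) (hq x)

open scoped Classical in
theorem IsPreconnectedOn.union {G : SimpleGraph V} {U : Finset V} (hU : IsPreconnectedOn G U)
    {u : V} (hu : u ∈ U) (J : Finset V) (hJ : ∀ i ∈ J, G.Adj i u) : IsPreconnectedOn G (U ∪ J) := by
  induction J using Finset.induction_on with
  | empty => simpa using hU
  | insert i J _ ih =>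
    rw [Finset.union_insert]
    exact (ih fun j hj => hJ j (Finset.mem_insert_of_mem hj)).insert_vertex (Finset.mem_union_left _ hu)
      (hJ i (Finset.mem_insert_self _ _))

/-- In a forest, a vertex outside a connected set has at most one neighbour in it. -/
theorem IsPreconnectedOn.eq_of_adj {G : SimpleGraph V} (hG : G.IsAcyclic) {U : Finset V}
    (hU : IsPreconnectedOn G U) {w u v : V} (hw : w ∉ U) (hu : u ∈ U) (hv : v ∈ U)
    (hwu : G.Adj w u) (hwv : G.Adj w v) : u = v := by
  classical
  by_contra hne
  obtain ⟨p, hp⟩ := hU u hu v hv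
  have hq : (SimpleGraph.Walk.cons hwu.symm (SimpleGraph.Walk.cons hwv .nil)).IsPath := by
    simp [SimpleGraph.Walk.cons_isPath_iff, hwu.ne', hwv.ne, hne]
  have h := congrArg Subtype.val ((hG.subsingleton_path u v).elim ⟨_, hq⟩ ⟨_, p.bypass_isPath⟩)
  simp only at h
  have hmem : w ∈ p.bypass.support := by rw [← h]; simp
  exact hw (hp w (p.support_bypass_subset_support hmem))

/-- The outer end of an edge leaving a connected set has, by acyclicity, no second neighbour in it,
so it can be attached as a leaf. The number `n` bounds the vertices still missing. -/
theorem IsRealizedOn.univ [Fintype V] {G : SimpleGraph V} (hG : G.IsTree) {M : Type*}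
    [AddCommGroup M] (n : ℕ) : ∀ (U : Finset V), Fintype.card V ≤ U.card + n → U.Nonempty →
      IsPreconnectedOn G U → IsRealizedOn G U M → IsRealizedOn G Finset.univ M := by
  classical
  induction n with
  | zero =>
    intro U hcard _ _ h
    rwa [← (Finset.card_eq_iff_eq_univ U).1 (le_antisymm (Finset.card_le_univ U) hcard)]
  | succ n ih =>
    intro U hcard hne hU h
    by_cases huniv : U = Finset.univ
    · rwa [← huniv]
    · obtain ⟨z, hz⟩ : ∃ z, z ∉ U := by
        by_contra! hall
        exact huniv (Finset.eq_univ_iff_forall.2 hall)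
      obtain ⟨u₀, hu₀⟩ := hne
      obtain ⟨p⟩ := hG.1.preconnected u₀ z
      obtain ⟨e, -, he1, he2⟩ := p.exists_boundary_dart (U : Set V) hu₀ hz
      have he1 : e.fst ∈ U := he1
      have he2 : e.snd ∉ U := he2
      refine ih (insert e.snd U) ?_ (Finset.insert_nonempty _ _) (hU.insert_vertex he1 e.adj.symm)
        (h.insert_leaf he2 he1 fun v hv => ⟨fun hadj => ?_, fun hve => hve ▸ e.adj.symm⟩)
      · rw [Finset.card_insert_of_notMem he2]; omega
      · exact hU.eq_of_adj hG.2 he2 hv he1 hadj e.adj.symm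

/-- Every required non-adjacency comes from uniqueness of the neighbour in a connected set, applied
to `U`, to `U` with `c` added, and to single edges at `c`. -/
theorem IsPreconnectedOn.isPendantStar {G : SimpleGraph V} (hG : G.IsAcyclic) {U : Finset V}
    (hU : IsPreconnectedOn G U) {c v₀ i₀ : V} {J : Finset V} (hc : c ∉ U) (hv₀ : v₀ ∈ U)
    (hcv : G.Adj c v₀) (hi₀ : i₀ ∉ J) (hiv : i₀ ≠ v₀) (hJv : v₀ ∉ J) (hi : G.Adj c i₀)
    (hJ : ∀ i ∈ J, G.Adj c i) : IsPendantStar G U v₀ c i₀ J := by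
  classical
  have hnot : ∀ i, G.Adj c i → i ≠ v₀ → i ∉ U := fun i h1 h2 h3 =>
    h2 (hU.eq_of_adj hG hc h3 hv₀ h1 hcv)
  have hUc := hU.insert_vertex hv₀ hcv
  have hnotadj : ∀ i, G.Adj c i → i ≠ v₀ → ∀ v ∈ U, ¬ G.Adj v i := by
    intro i h1 h2 v hv h3
    have h4 : i ∉ insert c U := by
      rw [Finset.mem_insert]
      exact fun h => h.elim h1.ne' (hnot i h1 h2)
    exact hc (hUc.eq_of_adj hG h4 (Finset.mem_insert_of_mem hv) (Finset.mem_insert_self c U)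
      h3.symm h1.symm ▸ hv)
  have htri : ∀ i j, G.Adj c i → G.Adj c j → ¬ G.Adj i j := by
    intro i j h1 h2 h3
    have h := ((isPreconnectedOn_singleton G c).insert_vertex (Finset.mem_singleton_self c)
      h2.symm).eq_of_adj hG (w := i) (u := c) (v := j) (by simp [h3.ne, h1.ne']) (by simp) (by simp)
      h1.symm h3
    exact h2.ne h
  have hJne : ∀ i ∈ J, i ≠ v₀ := fun i hi h => hJv (h ▸ hi)
  exact
    { mem := hv₀
      center_notMem := hc
      ne_center := hi.ne'
      center_notMem_leaves := fun h => G.irrefl (hJ c h)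
      notMem := hnot i₀ hi hiv
      notMem_leaves := hi₀
      disjoint := fun i hi => hnot i (hJ i hi) (hJne i hi)
      adj_iff := fun v hv => ⟨fun h => hU.eq_of_adj hG hc hv hv₀ h hcv, fun h => h ▸ hcv⟩
      adj := hi
      adj_leaves := hJ
      not_adj := hnotadj i₀ hi hiv
      not_adj_leaves := fun v hv i hi => hnotadj i (hJ i hi) (hJne i hi) v hv
      not_adj_leaf := fun i hiJ => htri _ _ hi (hJ i hiJ)
      not_adj_of_leaves := fun i hi j hj => htri _ _ (hJ i hi) (hJ j hj) }

theorem IsRealizedOn.of_pendantStar [Fintype V] {G : SimpleGraph V} (hG : G.IsTree) {U : Finset V}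
    (hU : IsPreconnectedOn G U) {t a : ℕ} (h : IsRealizedOn G U (ℤ × (Fin t → ZMod 2))) {c v₀ : V}
    (hc : c ∉ U) (hv₀ : v₀ ∈ U) (hcv : G.Adj c v₀) (ha : a + 2 ≤ vertexDegree G c) :
    IsRealizedOn G Finset.univ (ℤ × (Fin (t + a) → ZMod 2)) := by
  classical
  have hmem : v₀ ∈ Finset.univ.filter (G.Adj c) := by simpa using hcv
  have hcard : ((Finset.univ.filter (G.Adj c)).erase v₀).card + 1 = vertexDegree G c := by
    rw [vertexDegree_eq_card]; exact Finset.card_erase_add_one hmem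
  obtain ⟨K, hK, hKcard⟩ := Finset.exists_subset_card_eq
    (show a + 1 ≤ ((Finset.univ.filter (G.Adj c)).erase v₀).card by omega)
  have hKadj : ∀ i ∈ K, G.Adj c i := fun i hi => by
    simpa using Finset.mem_of_mem_erase (hK hi)
  have hKne : ∀ i ∈ K, i ≠ v₀ := fun i hi => Finset.ne_of_mem_erase (hK hi)
  obtain ⟨i₀, hi₀⟩ := Finset.card_pos.1 (show 0 < K.card by omega)
  have hJcard : (K.erase i₀).card = a := by rw [Finset.card_erase_of_mem hi₀, hKcard]; rfl
  have hs := hU.isPendantStar hG.2 (J := K.erase i₀) hc hv₀ hcv (Finset.notMem_erase _ _)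
    (hKne i₀ hi₀) (fun h => hKne _ (Finset.mem_of_mem_erase h) rfl) (hKadj i₀ hi₀)
    (fun i hi => hKadj i (Finset.mem_of_mem_erase hi))
  -- For even `a`, `k = 1` suffices; for odd `a`, `k = 2` repairs the parity of `2 + k * a`.
  obtain ⟨k, e, hk, he, hke⟩ : ∃ k e : ℤ, 0 < k ∧ 0 ≤ e ∧ 2 * k * e = 2 + k * (K.erase i₀).card := by
    rw [hJcard]
    obtain ⟨b, rfl | rfl⟩ := Nat.even_or_odd' a
    · exact ⟨1, 1 + b, by omega, by omega, by push_cast; ring⟩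
    · exact ⟨2, 1 + b, by omega, by omega, by push_cast; ring⟩
  have hreal := hs.isRealizedOn h k e hk he hke
  have hconn : IsPreconnectedOn G (U ∪ insert c (insert i₀ (K.erase i₀))) := by
    rw [Finset.union_insert, ← Finset.insert_union]
    refine (hU.insert_vertex hv₀ hcv).union (Finset.mem_insert_self c U) _ fun i hi => ?_
    rw [Finset.insert_erase hi₀] at hi
    exact (hKadj i hi).symm
  have huniv := IsRealizedOn.univ hG (Fintype.card V) _ (by omega)
    ⟨v₀, Finset.mem_union_left _ hv₀⟩ hconn hreal
  let σ : Fin (t + a) ≃ Fin t ⊕ (K.erase i₀ : Finset V) :=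
    finSumFinEquiv.symm.trans (Equiv.sumCongr (Equiv.refl _)
      ((finCongr hJcard.symm).trans (K.erase i₀).equivFin.symm))
  refine huniv.of_addEquiv (AddEquiv.prodAssoc.trans (AddEquiv.prodCongr (AddEquiv.refl _) ?_))
  exact (LinearEquiv.sumArrowLequivProdArrow _ _ ℤ (ZMod 2)).symm.toAddEquiv.trans
    (LinearEquiv.funCongrLeft ℤ (ZMod 2) σ).toAddEquiv

theorem isHarmonicOn_map_iff {B : Type u} {N : Type*} [AddCommGroup N] {T : SimpleGraph V}
    {G : SimpleGraph B} (φ : B ↪ V) (hφ : ∀ b b', T.Adj (φ b) (φ b') ↔ G.Adj b b') (U : Finset B)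
    (d : V → ℤ) (g : V → N) :
    IsHarmonicOn T (U.map φ) d g ↔ IsHarmonicOn G U (d ∘ φ) (g ∘ φ) := by
  classical
  simp [IsHarmonicOn, Finset.sum_map, hφ]

theorem IsRealizedOn.map {B : Type u} {M : Type*} [AddCommGroup M] {T : SimpleGraph V}
    {G : SimpleGraph B} (φ : B ↪ V) (hφ : ∀ b b', T.Adj (φ b) (φ b') ↔ G.Adj b b') {U : Finset B}
    (h : IsRealizedOn G U M) : IsRealizedOn T (U.map φ) M := by
  obtain ⟨d, r, f, h1, h2, h3, h4, h5, h6, h7⟩ := h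
  have hext' : ∀ (g : B → ℤ) b, Function.extend φ g 0 (φ b) = g b :=
    fun g b => φ.injective.extend_apply g _ b
  have hext'' : ∀ b, Function.extend φ f 0 (φ b) = f b := fun b => φ.injective.extend_apply f _ b
  refine ⟨Function.extend φ d 0, Function.extend φ r 0, Function.extend φ f 0, ?_, ?_,
    fun k hk => h3 k fun b hb => ?_, (isHarmonicOn_map_iff φ hφ U _ _).2 ?_,
    (isHarmonicOn_map_iff φ hφ U _ _).2 ?_, fun H hH => h6 H fun b hb => ?_, fun N _ g hg => ?_⟩
  · simpa [hext'] using h1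
  · simpa [hext'] using h2
  · simpa [hext'] using hk (φ b) (Finset.mem_map_of_mem φ hb)
  · exact h4.congr (fun b _ => (hext' d b).symm) fun b _ => (hext' r b).symm
  · exact h5.congr (fun b _ => (hext' d b).symm) fun b _ => (hext'' b).symm
  · simpa [hext''] using hH (φ b) (Finset.mem_map_of_mem φ hb)
  · obtain ⟨h, hh⟩ := h7 N (g ∘ φ) (((isHarmonicOn_map_iff φ hφ U _ g).1 hg).congr
      (fun b _ => hext' d b) fun _ _ => rfl)
    exact ⟨h, by simpa [hext''] using hh⟩

theorem SimpleGraph.Connected.isPreconnectedOn_map {B : Type u} [Fintype B] {T : SimpleGraph V}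
    {G : SimpleGraph B} (hG : G.Connected) (φ : B ↪ V)
    (hφ : ∀ b b', G.Adj b b' → T.Adj (φ b) (φ b')) :
    IsPreconnectedOn T (Finset.univ.map φ) := by
  intro a ha b hb
  obtain ⟨a, -, rfl⟩ := Finset.mem_map.1 ha
  obtain ⟨b, -, rfl⟩ := Finset.mem_map.1 hb
  obtain ⟨p⟩ := hG.preconnected a b
  let F : G →g T := ⟨φ, fun h => hφ _ _ h⟩
  refine ⟨p.map F, fun x hx => ?_⟩
  rw [SimpleGraph.Walk.support_map, List.mem_map] at hx
  obtain ⟨z, -, rfl⟩ := hx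
  exact Finset.mem_map_of_mem φ (Finset.mem_univ z)

theorem isRealizedOn_singleton_zero (G : SimpleGraph V) (v : V) :
    IsRealizedOn G {v} (ℤ × (Fin 0 → ZMod 2)) :=
  (isRealizedOn_singleton G v).of_addEquiv AddEquiv.prodUnique.symm

end Growth

/-! ### Assembling the structure and computing the critical group -/

section Decomposition

variable {V : Type u} [Fintype V]

theorem IsStarlikeDecomposition.leafExcess_nonneg {T : SimpleGraph V} {L : List FiniteGraph.{u}}
    (hL : IsStarlikeDecomposition T L) (hV : 2 ≤ Fintype.card V) : 0 ≤ leafExcess L := by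
  induction hL with
  | @single V _ T hT high =>
    have hex : leafExcess [⟨V, inferInstance, T⟩] = (numLeaves T : ℤ) - 2 := by simp [leafExcess]
    by_cases h : ∃ c, 3 ≤ vertexDegree T c
    · obtain ⟨c, hc⟩ := h
      rw [hex, numLeaves_eq_vertexDegree hT hc fun v hv => ?_]
      · omega
      · by_contra h3
        exact hv (high v c (by omega) hc)
    · rw [hex, numLeaves_eq_two hT hV fun v => ?_]
      · norm_num
      · by_contra h3
        exact h ⟨v, by omega⟩
  | @split V A B _ _ _ T S T' x y L hs _ ih =>
    have hex : leafExcess (⟨A, inferInstance, S⟩ :: L) = (numLeaves S : ℤ) - 2 + leafExcess L := by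
      simp [leafExcess]
    obtain ⟨c, -, -, -, -, hc3, hleaves⟩ := hs.exists_center
    have := ih hs.two_le_card
    omega

theorem IsStarlikeDecomposition.isRealizedOn {T : SimpleGraph V} {L : List FiniteGraph.{u}}
    (hL : IsStarlikeDecomposition T L) (hV : 2 ≤ Fintype.card V) (t : ℕ)
    (ht : (t : ℤ) ≤ leafExcess L) : IsRealizedOn T Finset.univ (ℤ × (Fin t → ZMod 2)) := by
  classical
  induction hL generalizing t with
  | @single V _ T hT high =>
    have hex : leafExcess [⟨V, inferInstance, T⟩] = (numLeaves T : ℤ) - 2 := by simp [leafExcess]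
    rw [hex] at ht
    by_cases h : ∃ c, 3 ≤ vertexDegree T c
    · obtain ⟨c, hc⟩ := h
      rw [numLeaves_eq_vertexDegree hT hc fun v hv => by
        by_contra h3
        exact hv (high v c (by omega) hc)] at ht
      obtain ⟨u, hu⟩ : ∃ u, T.Adj c u := by
        rw [vertexDegree_eq_card] at hc
        obtain ⟨u, hu⟩ := Finset.card_pos.1 (show 0 < (Finset.univ.filter (T.Adj c)).card by omega)
        exact ⟨u, by simpa using hu⟩
      -- One neighbour of the centre is the starting set, so all of `t` is produced by a single
      -- star.
      have := (isRealizedOn_singleton_zero T u).of_pendantStar hT (isPreconnectedOn_singleton T u)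
        (a := t) (by simpa using hu.ne) (Finset.mem_singleton_self u) hu (by omega)
      rwa [zero_add] at this
    · rw [numLeaves_eq_two hT hV fun v => by
        by_contra h3
        exact h ⟨v, by omega⟩] at ht
      obtain rfl : t = 0 := by omega
      obtain ⟨v⟩ := hT.1.nonempty
      exact IsRealizedOn.univ hT (Fintype.card V) {v} (by omega) (Finset.singleton_nonempty v)
        (isPreconnectedOn_singleton T v) (isRealizedOn_singleton_zero T v)
  | @split V A B _ _ _ T S T' x y L hs hL' ih =>
    obtain ⟨f, g, h1, h2, h3⟩ := hs.merge
    have hm : IsMerge T S x T' y f g := ⟨h1, h2, h3⟩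
    obtain ⟨c, hcx, hxc, -, -, hc3, hleaves⟩ := hs.exists_center
    have hex : leafExcess (⟨A, inferInstance, S⟩ :: L) = (numLeaves S : ℤ) - 2 + leafExcess L := by
      simp [leafExcess]
    rw [hex, hleaves] at ht
    have h0 := hL'.leafExcess_nonneg hs.two_le_card
    have hdeg : vertexDegree S c ≤ vertexDegree T (f c) := by
      rw [vertexDegree_eq_card, vertexDegree_eq_card, ← Finset.card_map f]
      refine Finset.card_le_card fun w hw => ?_
      simp only [Finset.mem_map, Finset.mem_filter, Finset.mem_univ, true_and] at hw ⊢
      obtain ⟨a, ha, rfl⟩ := hw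
      exact hm.adj_left ha
    obtain ⟨t', a, rfl, ht', ha⟩ : ∃ t' a : ℕ, t = t' + a ∧ (t' : ℤ) ≤ leafExcess L ∧
        a + 2 ≤ vertexDegree S c := by
      -- The star takes as much of `t` as it can. When it takes everything, the remainder `0` is
      -- admissible for `T'` because the leaf excess of `L` is nonnegative.
      refine ⟨t - min t (vertexDegree S c - 2), min t (vertexDegree S c - 2), ?_, ?_, ?_⟩ <;> omega
    refine ((ih hs.two_le_card t' ht').map g
      fun b b' => ⟨hm.of_adj_right, hm.adj_right⟩).of_pendantStar hs.isTree
      (hs.isTree'.1.isPreconnectedOn_map g fun b b' => hm.adj_right) (c := f c) (v₀ := f x)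
      ?_ ?_ (hm.adj_left hxc.symm) (ha.trans hdeg)
    · intro h
      obtain ⟨b, -, hb⟩ := Finset.mem_map.1 h
      exact hcx ((h1 c b).1 hb.symm).1
    · rw [hm.apply_eq]
      exact Finset.mem_map_of_mem g (Finset.mem_univ y)

/-- Both `M` and the cokernel carry generating universal harmonic functions, so the two induced maps
are mutually inverse. -/
theorem IsRealizedOn.exists_isArithmeticalStructure {G : SimpleGraph V} {M : Type*} [AddCommGroup M]
    (h : IsRealizedOn G Finset.univ M) :
    ∃ d r : V → ℤ, IsArithmeticalStructure G d r ∧ Nonempty (LaplacianCokernel G d ≃+ M) := by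
  obtain ⟨d, r, f, h1, h2, h3, h4, h5, h6, h7⟩ := h
  refine ⟨d, r, ⟨fun v => h1 v (Finset.mem_univ v), fun v => h2 v (Finset.mem_univ v),
    fun k hk => h3 k fun v _ => hk v,
    (isHarmonicAt_iff_mulVec_eq_zero G d r).1 (isHarmonicOn_univ.1 h4)⟩, ?_⟩
  obtain ⟨φ, hφ⟩ := exists_cokernel_lift (isHarmonicOn_univ.1 h5)
  obtain ⟨ψ, hψ⟩ := h7 (LaplacianCokernel G d) (vertexClass G d)
    (isHarmonicOn_univ.2 (isHarmonicAt_vertexClass G d))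
  refine ⟨AddMonoidHom.toAddEquiv φ ψ ?_ ?_⟩
  · exact cokernel_induction _ _ fun v => by simp [hφ, hψ]
  · have := h6 (AddMonoidHom.eqLocus (φ.comp ψ) (AddMonoidHom.id M)) fun v hv => by
      change φ (ψ (f v)) = f v
      rw [hψ v hv, hφ]
    refine AddMonoidHom.ext fun m => ?_
    have hm : m ∈ AddMonoidHom.eqLocus (φ.comp ψ) (AddMonoidHom.id M) := this ▸ AddSubgroup.mem_top m
    exact hm

theorem nonempty_torsion_addEquiv {C F : Type*} [AddCommGroup C] [AddCommGroup F] (E : C ≃+ ℤ × F)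
    (n : ℤ) (hn : n ≠ 0) (hF : ∀ y : F, n • y = 0) : Nonempty (Submodule.torsion ℤ C ≃+ F) := by
  let φ : Submodule.torsion ℤ C →+ F :=
    ((AddMonoidHom.snd ℤ F).comp E.toAddMonoidHom).comp
      (Submodule.torsion ℤ C).subtype.toAddMonoidHom
  have hφ : ∀ x, φ x = (E x).2 := fun _ => rfl
  refine ⟨AddEquiv.ofBijective φ ⟨(injective_iff_map_eq_zero φ).2 ?_, fun y => ?_⟩⟩
  · rintro ⟨x, hx⟩ h0
    obtain ⟨a, ha⟩ := (Submodule.mem_torsion_iff x).1 hx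
    have h1 : (a : ℤ) • E x = 0 := by rw [← map_zsmul]; exact (congrArg E ha).trans (map_zero E)
    have h2 : (E x).1 = 0 := by
      have := congrArg Prod.fst h1
      simpa using this
    refine Subtype.ext (E.injective ?_)
    rw [ZeroMemClass.coe_zero, map_zero]
    exact Prod.ext h2 h0
  · refine ⟨⟨E.symm (0, y), (Submodule.mem_torsion_iff _).2
      ⟨⟨n, mem_nonZeroDivisors_of_ne_zero hn⟩, ?_⟩⟩, ?_⟩
    · change n • E.symm (0, y) = 0
      rw [← map_zsmul, Prod.smul_mk, hF, smul_zero]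
      exact map_zero E.symm
    · rw [hφ]; simp

end Decomposition

theorem theorem4p3 {V : Type u} [Fintype V] (hV : 2 ≤ Fintype.card V)
    (T : SimpleGraph V) (hT : T.IsTree)
    (L : List FiniteGraph.{u}) (hL : IsStarlikeDecomposition T L) :
    (∀ d r : V → ℤ, IsArithmeticalStructure T d r →
      (∃ s : ℕ, HasNumInvariantFactors (CriticalGroup T d) s) ∧
      ∀ s : ℕ, HasNumInvariantFactors (CriticalGroup T d) s → (s : ℤ) ≤ leafExcess L) ∧
    (∀ t : ℕ, (t : ℤ) ≤ leafExcess L →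
      ∃ d r : V → ℤ, IsArithmeticalStructure T d r ∧
        HasNumInvariantFactors (CriticalGroup T d) t ∧
        Nonempty (CriticalGroup T d ≃+ (Fin t → ZMod 2))) := by
  have := hT.1.nonempty
  refine ⟨fun d r hdr => ⟨?_, fun s hs => ?_⟩, fun t ht => ?_⟩
  · have : Finite (CriticalGroup T d) := Module.finite_of_fg_torsion _ Submodule.torsion_isTorsion
    exact exists_hasNumInvariantFactors_of_finite _
  · exact hasNumInvariantFactors_le_of_zeroForcing hdr hs fun p => hL.exists_zeroForcing (ZMod p) hV
  · obtain ⟨d, r, hdr, ⟨E⟩⟩ := (hL.isRealizedOn hV t ht).exists_isArithmeticalStructure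
    obtain ⟨E'⟩ := nonempty_torsion_addEquiv E 2 two_ne_zero fun y => funext fun i => by
      rw [Pi.smul_apply, zsmul_eq_mul, show ((2 : ℤ) : ZMod 2) = 0 from rfl, zero_mul, Pi.zero_apply]
    exact ⟨d, r, hdr, ⟨fun _ => 2, fun _ => one_lt_two, fun _ _ _ => dvd_rfl, ⟨E'⟩⟩, ⟨E'⟩⟩
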